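/- Let $d\in\{2,3\}$. Let $\xi$ be a (real) white noise on $\mathbb{R}^d$, i.e. a random real tempered distribution such that for every real Schwartz function $\varphi$ the random variable $\langle\xi,\varphi\rangle$ is centred Gaussian with variance $\|\varphi\|_{L^2}^2$. Let $\varrho:\mathbb{R}^d\to\mathbb{R}$ be even, smooth, supported in the closed unit ball, with $\int\varrho=1$; for $\varepsilon\in(0,1)$ set $\varrho_\varepsilon(x)=\varepsilon^{-d}\varrho(x/\varepsilon)$ and $\xi_\varepsilon=\xi*\varrho_\varepsilon$, that is $\xi_\varepsilon(x)=\langle\xi,\varrho_\varepsilon(x-\cdot)\rangle$. Let $C_\varepsilon\in\mathbb{R}$ be a deterministic constant. For every $\varepsilon\in(0,1)$, almost surely the operator $-\Delta+\xi_\varepsilon+C_\varepsilon$ on $L^2(\mathbb{R}^d;\mathbb{C})$ is essentially self-adjoint on $C_c^\infty(\mathbb{R}^d)$, and the spectrum of its closure $\mathcal{H}_\varepsilon$ is $\mathbb{R}$. -/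

import Mathlib

open MeasureTheory ProbabilityTheory
open scoped SchwartzMap Laplacian

noncomputable section

namespace AndersonHamiltonian

/-- The Euclidean space `ℝ^d`. -/
abbrev Space (d : ℕ) : Type := EuclideanSpace ℝ (Fin d)

/-- The complex Hilbert space `L²(ℝ^d, dx)`. -/
abbrev L2 (d : ℕ) : Type := Lp ℂ 2 (volume : Measure (Space d))

/-! ### White noise and its regularisation -/

/-- `ξ` is a (real) white noise on `ℝ^d`: a random real tempered distribution such that for every
test function `φ` the random variable `⟨ξ, φ⟩` is a centred Gaussian of variance `‖φ‖²_{L²}`.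
By linearity in `φ`, `(⟨ξ, φ⟩)_φ` is then a centred Gaussian family with covariance
`⟨φ, ψ⟩_{L²}`. -/
def IsWhiteNoise {d : ℕ} {Ω : Type*} [MeasurableSpace Ω] (P : Measure Ω)
    (ξ : Ω → (𝓢(Space d, ℝ) →L[ℝ] ℝ)) : Prop :=
  ∀ φ : 𝓢(Space d, ℝ),
    HasLaw (fun ω => ξ ω φ) (gaussianReal 0 (∫ y, φ y ^ 2).toNNReal) P

/-- `ϱ` is an even smooth function, compactly supported in the unit ball, of integral one. -/
structure IsMollifier {d : ℕ} (ϱ : Space d → ℝ) : Prop where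
  contDiff : ContDiff ℝ (⊤ : ℕ∞) ϱ
  tsupport_subset : tsupport ϱ ⊆ Metric.closedBall 0 1
  even : ∀ y, ϱ (-y) = ϱ y
  integral_eq_one : ∫ y, ϱ y = 1

/-- The rescaled function `ϱ_ε(y) = ε^{-d} ϱ(y / ε)`. -/
def rescale {d : ℕ} (ϱ : Space d → ℝ) (ε : ℝ) (y : Space d) : ℝ :=
  (ε ^ d)⁻¹ * ϱ (ε⁻¹ • y)

theorem IsMollifier.contDiff_rescale {d : ℕ} {ϱ : Space d → ℝ} (hϱ : IsMollifier ϱ) (ε : ℝ)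
    (x : Space d) : ContDiff ℝ (⊤ : ℕ∞) (fun y => rescale ϱ ε (x - y)) := by
  have h : ContDiff ℝ (⊤ : ℕ∞) (fun y : Space d => ε⁻¹ • (x - y)) :=
    (contDiff_const.sub contDiff_id).const_smul _
  exact contDiff_const.mul (hϱ.contDiff.comp h)

theorem IsMollifier.hasCompactSupport_rescale {d : ℕ} {ϱ : Space d → ℝ} (hϱ : IsMollifier ϱ)
    {ε : ℝ} (hε : 0 < ε) (x : Space d) :
    HasCompactSupport (fun y => rescale ϱ ε (x - y)) := by
  refine HasCompactSupport.intro (isCompact_closedBall x ε) fun y hy => ?_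
  have h0 : ϱ (ε⁻¹ • (x - y)) = 0 := by
    refine image_eq_zero_of_notMem_tsupport fun hmem => hy ?_
    have h1 := hϱ.tsupport_subset hmem
    rw [mem_closedBall_zero_iff, norm_smul, norm_inv, Real.norm_of_nonneg hε.le,
      inv_mul_le_iff₀ hε, mul_one] at h1
    rw [Metric.mem_closedBall, dist_comm, dist_eq_norm]
    exact h1
  simp [rescale, h0]

/-- The test function `y ↦ ϱ_ε(x - y)`. -/
def mollifierAt {d : ℕ} {ϱ : Space d → ℝ} (hϱ : IsMollifier ϱ) {ε : ℝ} (hε : 0 < ε)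
    (x : Space d) : 𝓢(Space d, ℝ) :=
  (hϱ.hasCompactSupport_rescale hε x).toSchwartzMap (hϱ.contDiff_rescale ε x)

/-- The regularisation `ξ_ε = ξ * ϱ_ε` of a distribution, `ξ_ε(x) = ⟨ξ, ϱ_ε(x - ·)⟩`. -/
def smoothed {d : ℕ} {ϱ : Space d → ℝ} (hϱ : IsMollifier ϱ) {ε : ℝ} (hε : 0 < ε)
    (ξ : 𝓢(Space d, ℝ) →L[ℝ] ℝ) (x : Space d) : ℝ :=
  ξ (mollifierAt hϱ hε x)

/-! ### Schrödinger operators and their spectrum -/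

/-- The graph in `L² × L²` of `φ ↦ -Δφ + Vφ`, for `φ` ranging over the complex-valued functions in
`C_c^∞(ℝ^d)` such that `-Δφ + Vφ` lies in `L²`; for continuous `V` these are all of
`C_c^∞(ℝ^d)`. -/
def schrodingerGraph {d : ℕ} (V : Space d → ℝ) : Submodule ℂ (L2 d × L2 d) where
  carrier := {p | ∃ φ : Space d → ℂ, ContDiff ℝ (⊤ : ℕ∞) φ ∧ HasCompactSupport φ ∧
    p.1 =ᵐ[volume] φ ∧ p.2 =ᵐ[volume] fun x => -(Δ φ x) + (V x : ℂ) * φ x}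
  zero_mem' := by
    refine ⟨fun _ => 0, contDiff_const, HasCompactSupport.zero, Lp.coeFn_zero _ _ _, ?_⟩
    filter_upwards [Lp.coeFn_zero ℂ 2 (volume : Measure (Space d))] with x hx
    have h : Δ (fun _ : Space d => (0 : ℂ)) x = 0 := by
      have := InnerProductSpace.laplacian_const (E := Space d) (c := (0 : ℂ))
      exact congrFun this x
    simp [h]
  add_mem' := by
    rintro p q ⟨φ, hφ, hφc, hp1, hp2⟩ ⟨ψ, hψ, hψc, hq1, hq2⟩
    refine ⟨φ + ψ, hφ.add hψ, hφc.add hψc, ?_, ?_⟩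
    · exact (Lp.coeFn_add _ _).trans (hp1.add hq1)
    · filter_upwards [Lp.coeFn_add p.2 q.2, hp2, hq2] with x hx h1 h2
      have h : Δ (φ + ψ) x = Δ φ x + Δ ψ x :=
        (contDiff_infty.1 hφ 2).contDiffAt.laplacian_add
          (contDiff_infty.1 hψ 2).contDiffAt
      simp only [Prod.snd_add, hx, Pi.add_apply, h1, h2, h]
      ring
  smul_mem' := by
    rintro c p ⟨φ, hφ, hφc, hp1, hp2⟩
    refine ⟨c • φ, contDiff_const.smul hφ, hφc.smul_left, ?_, ?_⟩
    · exact (Lp.coeFn_smul _ _).trans (hp1.const_smul c)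
    · filter_upwards [Lp.coeFn_smul c p.2, hp2] with x hx h1
      have h : Δ (c • φ) x = c • Δ φ x :=
        InnerProductSpace.laplacian_smul c (contDiff_infty.1 hφ 2).contDiffAt
      simp only [Prod.smul_snd, hx, Pi.smul_apply, h1, h, smul_eq_mul]
      ring

/-- The relation `schrodingerGraph V` is single-valued, hence the graph of an operator. -/
theorem schrodingerGraph_single_valued {d : ℕ} (V : Space d → ℝ) (p : L2 d × L2 d)
    (hp : p ∈ schrodingerGraph V) (h0 : p.1 = 0) : p.2 = 0 := by
  obtain ⟨φ, hφ, -, h1, h2⟩ := hp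
  have hz : φ = fun _ => 0 := by
    refine (hφ.continuous.ae_eq_iff_eq volume continuous_const).1 (h1.symm.trans ?_)
    rw [h0]
    exact Lp.coeFn_zero _ _ _
  subst hz
  refine Lp.ext (h2.trans ?_)
  filter_upwards [Lp.coeFn_zero ℂ 2 (volume : Measure (Space d))] with x hx
  have h : Δ (fun _ : Space d => (0 : ℂ)) x = 0 :=
    congrFun (InnerProductSpace.laplacian_const (E := Space d) (c := (0 : ℂ))) x
  rw [hx]
  simp [h]

/-- The operator `-Δ + V` on `L²(ℝ^d)` with domain `C_c^∞(ℝ^d)`. -/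
def minimalOperator {d : ℕ} (V : Space d → ℝ) : L2 d →ₗ.[ℂ] L2 d :=
  (schrodingerGraph V).toLinearPMap

/-- The Schrödinger operator `-Δ + V` on `L²(ℝ^d)`: the closure of its restriction to
`C_c^∞(ℝ^d)`. -/
def schrodinger {d : ℕ} (V : Space d → ℝ) : L2 d →ₗ.[ℂ] L2 d :=
  (minimalOperator V).closure

/-- The resolvent set of an unbounded operator `T`: those `z ∈ ℂ` for which `T - z` is a bijection
from the domain of `T` onto the whole space with bounded inverse `R`. -/
def resolventSet {H : Type*} [NormedAddCommGroup H] [NormedSpace ℂ H] (T : H →ₗ.[ℂ] H) : Set ℂ :=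
  {z | ∃ R : H →L[ℂ] H,
    (∀ f : H, ∃ h : R f ∈ T.domain, T ⟨R f, h⟩ - z • R f = f) ∧
    ∀ u : T.domain, R (T u - z • (u : H)) = u}

/-- The spectrum of an unbounded operator, as a subset of `ℂ`. -/
def spectrum {H : Type*} [NormedAddCommGroup H] [NormedSpace ℂ H] (T : H →ₗ.[ℂ] H) : Set ℂ :=
  (resolventSet T)ᶜ

/-- The smoothed Anderson Hamiltonian `-Δ + ξ_ε + C`. -/
def smoothedHamiltonian {d : ℕ} {ϱ : Space d → ℝ} (hϱ : IsMollifier ϱ) {ε : ℝ} (hε : 0 < ε)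
    (C : ℝ) (ξ : 𝓢(Space d, ℝ) →L[ℝ] ℝ) : L2 d →ₗ.[ℂ] L2 d :=
  schrodinger fun x => smoothed hϱ hε ξ x + C

end AndersonHamiltonian

end

/-! The argument is pathwise. Almost surely the potential `V = ξ_ε + C` is continuous, grows at most
linearly, and is nearly equal to every real constant on arbitrarily large balls; any deterministic
potential with these properties gives a self-adjoint closure with spectrum `ℝ`.

Self-adjointness (`isSelfAdjoint_closure`, `weak_solution_eq_zero`): it is enough that `(-Δ + V - z)
w = 0` has no nonzero weak solution in `L²` when `Im z ≠ 0`. Test the equation with `χ² w̄`, where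
`χ` is a cutoff at radius `r`. The real part bounds `∫ χ² |∇w|²` by `O(r) ‖w‖²`, because `V = O(r)`
on the support of `χ`. In the imaginary part only `∇χ` terms compete with `|Im z| ∫ χ² |w|²`; they
are of size `r⁻¹ · r^(1/2)` and vanish as `r → ∞`. As `w` is only in `L²`, the computation is made
for its mollifications.

Spectrum (`spectrum_schrodinger`): nonreal points are in the resolvent set by the same vanishing
result. For real `l`, a wide cutoff placed where `V ≈ l` is an approximate eigenvector
(`exists_approx_eigenvector`).

Linear growth (`IsWhiteNoise.ae_linear_growth`): Gaussian tails and Borel–Cantelli control the noise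
on finer and finer grids. Between grid points the Lipschitz constant of a smoothed tempered
distribution grows only polynomially.

Flat regions (`IsWhiteNoise.ae_forall_exists_flat`): split the noise on a ball into a multiple of
`⟨ξ, X⟩`, with `X` a cutoff equal to one near the ball, and an independent remainder. The first is
close to `l`, and the second is uniformly small, each with positive probability. Distant translates
are independent with the same law, so one of them succeeds almost surely. -/

noncomputable section

namespace AndersonHamiltonian

/-! ### Symmetric operators: closures, resolvents and the basic criterion. -/

section FunctionalAnalysis

open scoped InnerProductSpace

variable {H : Type*} [NormedAddCommGroup H] [InnerProductSpace ℂ H]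

/-- A symmetric operator satisfies `|Im z| ‖u‖ ≤ ‖(A - z) u‖`. -/
theorem abs_im_mul_norm_le {u v : H} (h : ⟪v, u⟫_ℂ = ⟪u, v⟫_ℂ) (z : ℂ) :
    |z.im| * ‖u‖ ≤ ‖v - z • u‖ := by
  rcases eq_or_ne u 0 with rfl | hu
  · simp
  have hreal : (⟪u, v⟫_ℂ).im = 0 := by
    have h1 : (starRingEnd ℂ) ⟪u, v⟫_ℂ = ⟪u, v⟫_ℂ := by rw [inner_conj_symm, h]
    exact Complex.conj_eq_iff_im.1 h1
  -- Since `⟪u, v⟫` is real, only `z ‖u‖²` contributes to the imaginary part.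
  have him : (⟪u, v - z • u⟫_ℂ).im = - (z.im * ‖u‖ ^ 2) := by
    rw [inner_sub_right, inner_smul_right, inner_self_eq_norm_sq_to_K]
    have h2 : ((‖u‖ : ℂ) ^ 2) = ((‖u‖ ^ 2 : ℝ) : ℂ) := by push_cast; rfl
    have h3 : ∀ r : ℝ, (z * (r : ℂ)).im = z.im * r := fun r => by simp
    change (⟪u, v⟫_ℂ - z * (‖u‖ : ℂ) ^ 2).im = _
    rw [h2, Complex.sub_im, hreal, h3, zero_sub]
  have hle : |z.im| * ‖u‖ ^ 2 ≤ ‖u‖ * ‖v - z • u‖ := by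
    calc |z.im| * ‖u‖ ^ 2 = |(⟪u, v - z • u⟫_ℂ).im| := by
          rw [him, abs_neg, abs_mul, abs_of_nonneg (sq_nonneg ‖u‖)]
      _ ≤ ‖⟪u, v - z • u⟫_ℂ‖ := Complex.abs_im_le_norm _
      _ ≤ _ := norm_inner_le_norm _ _
  have hpos : 0 < ‖u‖ := norm_pos_iff.2 hu
  nlinarith

/-- Weyl's criterion: approximate eigenvectors give points of the spectrum. -/
theorem mem_spectrum_of_approx {T : H →ₗ.[ℂ] H} {z : ℂ}
    (h : ∀ δ > 0, ∃ u : T.domain, (u : H) ≠ 0 ∧ ‖T u - z • (u : H)‖ ≤ δ * ‖(u : H)‖) :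
    z ∈ spectrum T := by
  rintro ⟨R, -, hR⟩
  -- The added one keeps `δ` meaningful when `R = 0` and makes `‖R‖ δ < 1` strict.
  obtain ⟨u, hu0, hu⟩ := h (‖R‖ + 1)⁻¹ (by positivity)
  have hpos : 0 < ‖(u : H)‖ := norm_pos_iff.2 hu0
  have h1 : ‖(u : H)‖ ≤ ‖R‖ * ((‖R‖ + 1)⁻¹ * ‖(u : H)‖) := by
    calc ‖(u : H)‖ = ‖R (T u - z • (u : H))‖ := by rw [hR]
      _ ≤ ‖R‖ * ‖T u - z • (u : H)‖ := R.le_opNorm _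
      _ ≤ _ := by gcongr
  have h2 : ‖R‖ * ((‖R‖ + 1)⁻¹ * ‖(u : H)‖) < ‖(u : H)‖ := by
    rw [← mul_assoc, ← div_eq_mul_inv]
    have : ‖R‖ / (‖R‖ + 1) < 1 := by rw [div_lt_one (by positivity)]; linarith
    nlinarith
  linarith

variable [CompleteSpace H]

/-- The adjoint is a closed extension of a densely defined symmetric operator. -/
theorem isClosable_of_isFormalAdjoint {A : H →ₗ.[ℂ] H} (hd : Dense (A.domain : Set H))
    (hs : A.IsFormalAdjoint A) : A.IsClosable :=
  LinearPMap.isClosable_iff_exists_closed_extension.2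
    ⟨_, LinearPMap.adjoint_isClosed hd, hs.le_adjoint hd⟩

/-- Symmetry is a closed condition on pairs of graph points, so it passes to the closure of the
graph. -/
theorem isFormalAdjoint_closure {A : H →ₗ.[ℂ] H} (hd : Dense (A.domain : Set H))
    (hs : A.IsFormalAdjoint A) : A.closure.IsFormalAdjoint A.closure := by
  have hc := isClosable_of_isFormalAdjoint hd hs
  have hclosed : IsClosed {q : (H × H) × (H × H) | ⟪q.1.2, q.2.1⟫_ℂ = ⟪q.1.1, q.2.2⟫_ℂ} :=
    isClosed_eq (by fun_prop) (by fun_prop)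
  have hsub : (A.graph : Set (H × H)) ×ˢ (A.graph : Set (H × H)) ⊆
      {q : (H × H) × (H × H) | ⟪q.1.2, q.2.1⟫_ℂ = ⟪q.1.1, q.2.2⟫_ℂ} := by
    rintro ⟨p, q⟩ ⟨hp, hq⟩
    obtain ⟨x, hx1, hx2⟩ := (LinearPMap.mem_graph_iff _).1 hp
    obtain ⟨y, hy1, hy2⟩ := (LinearPMap.mem_graph_iff _).1 hq
    change ⟪p.2, q.1⟫_ℂ = ⟪p.1, q.2⟫_ℂ
    rw [← hx1, ← hx2, ← hy1, ← hy2]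
    exact hs x y
  have hcl := closure_minimal hsub hclosed
  rw [closure_prod_eq] at hcl
  have hg : closure (A.graph : Set (H × H)) = A.closure.graph := by
    rw [← hc.graph_closure_eq_closure_graph]; rfl
  rw [hg] at hcl
  intro x y
  exact @hcl (((x : H), A.closure x), ((y : H), A.closure y))
    ⟨LinearPMap.mem_graph _ x, LinearPMap.mem_graph _ y⟩

/-- Surjectivity of `A.closure - z` when the range of `A - z` is dense. -/
theorem exists_closure_sub_smul_eq {A : H →ₗ.[ℂ] H} (hd : Dense (A.domain : Set H))
    (hs : A.IsFormalAdjoint A) {z : ℂ} (hz : z.im ≠ 0)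
    (hr : ∀ u : H, (∀ x : A.domain, ⟪u, A x - z • (x : H)⟫_ℂ = 0) → u = 0) (f : H) :
    ∃ u : A.closure.domain, A.closure u - z • (u : H) = f := by
  have hc := isClosable_of_isFormalAdjoint hd hs
  have hsc := isFormalAdjoint_closure hd hs
  let S : A.closure.domain →ₗ[ℂ] H := A.closure.toFun - z • A.closure.domain.subtype
  have hS : ∀ u : A.closure.domain, S u = A.closure u - z • (u : H) := fun u => rfl
  have hbound : ∀ u : A.closure.domain, |z.im| * ‖(u : H)‖ ≤ ‖S u‖ := fun u =>
    abs_im_mul_norm_le (hsc u u) z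
  -- The lower bound turns convergent images into Cauchy preimages; closedness of the graph then
  -- puts the limit in the range.
  have hclosed : IsClosed (S.range : Set H) := by
    refine isClosed_of_closure_subset fun g hg => ?_
    obtain ⟨s, hsmem, hslim⟩ := mem_closure_iff_seq_limit.1 hg
    choose u hu using fun n => LinearMap.mem_range.1 (hsmem n)
    have hcauchy : CauchySeq fun n => (u n : H) := by
      have hsc := hslim.cauchySeq
      rw [Metric.cauchySeq_iff'] at hsc ⊢
      intro e he
      obtain ⟨N, hN⟩ := hsc (|z.im| * e) (mul_pos (abs_pos.2 hz) he)
      refine ⟨N, fun n hn => ?_⟩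
      have h1 := hbound (u n - u N)
      rw [map_sub, hu, hu, ← dist_eq_norm] at h1
      have h2 : |z.im| * dist (u n : H) (u N) < |z.im| * e := by
        rw [dist_eq_norm]
        exact h1.trans_lt (hN n hn)
      exact lt_of_mul_lt_mul_left h2 (abs_nonneg _)
    obtain ⟨w, hw⟩ := cauchySeq_tendsto_of_complete hcauchy
    have hA : Filter.Tendsto (fun n => A.closure (u n)) Filter.atTop (nhds (g + z • w)) := by
      have : (fun n => A.closure (u n)) = fun n => s n + z • (u n : H) := by
        ext n; rw [← hu n, hS]; abel
      rw [this]
      exact hslim.add (hw.const_smul z)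
    have hmem : (w, g + z • w) ∈ (A.closure.graph : Set (H × H)) :=
      hc.closure_isClosed.mem_of_tendsto (hw.prodMk_nhds hA)
        (Filter.Eventually.of_forall fun n => LinearPMap.mem_graph _ (u n))
    obtain ⟨x, hx1, hx2⟩ := (LinearPMap.mem_graph_iff _).1 hmem
    refine ⟨x, ?_⟩
    simp only at hx1 hx2
    rw [hS, hx1, hx2]; abel
  have hdense : S.rangeᗮ = ⊥ := by
    rw [Submodule.eq_bot_iff]
    intro u hu
    refine hr u fun x => ?_
    have hx : (x : H) ∈ A.closure.domain := A.le_closure.1 x.2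
    have hAx : A.closure ⟨x, hx⟩ = A x := (A.le_closure.2 rfl).symm
    have := (Submodule.mem_orthogonal' _ _).1 hu (S ⟨x, hx⟩) ⟨_, rfl⟩
    rwa [hS, hAx] at this
  have : S.range.HasOrthogonalProjection := by
    have : CompleteSpace S.range := hclosed.completeSpace_coe
    infer_instance
  have htop : S.range = ⊤ := (Submodule.orthogonal_eq_bot_iff).1 hdense
  obtain ⟨u, hu⟩ := LinearMap.mem_range.1 (htop ▸ Submodule.mem_top : f ∈ S.range)
  exact ⟨u, hu⟩

/-- Nonreal numbers belong to the resolvent set of an essentially self-adjoint operator. -/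
theorem mem_resolventSet_closure {A : H →ₗ.[ℂ] H} (hd : Dense (A.domain : Set H))
    (hs : A.IsFormalAdjoint A) {z : ℂ} (hz : z.im ≠ 0)
    (hr : ∀ u : H, (∀ x : A.domain, ⟪u, A x - z • (x : H)⟫_ℂ = 0) → u = 0) :
    z ∈ resolventSet A.closure := by
  have hsc := isFormalAdjoint_closure hd hs
  let S : A.closure.domain →ₗ[ℂ] H := A.closure.toFun - z • A.closure.domain.subtype
  have hbound : ∀ u : A.closure.domain, |z.im| * ‖(u : H)‖ ≤ ‖S u‖ := fun u =>
    abs_im_mul_norm_le (hsc u u) z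
  have hinj : Function.Injective S := by
    refine (injective_iff_map_eq_zero _).2 fun u hu => ?_
    have := hbound u
    rw [hu, norm_zero] at this
    have h0 : ‖(u : H)‖ ≤ 0 := by
      by_contra hcon
      exact absurd this (not_le.2 (mul_pos (abs_pos.2 hz) (not_le.1 hcon)))
    exact Subtype.ext (norm_le_zero_iff.1 h0)
  have hsurj : Function.Surjective S := exists_closure_sub_smul_eq hd hs hz hr
  let e := LinearEquiv.ofBijective S ⟨hinj, hsurj⟩
  have he : ∀ f, S (e.symm f) = f := fun f => e.apply_symm_apply f
  refine ⟨LinearMap.mkContinuous (A.closure.domain.subtype ∘ₗ e.symm.toLinearMap) |z.im|⁻¹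
    fun f => ?_, fun f => ⟨(e.symm f).2, he f⟩, fun u => ?_⟩
  · have := hbound (e.symm f)
    rw [he] at this
    rw [inv_mul_eq_div, le_div_iff₀ (abs_pos.2 hz), mul_comm]
    exact this
  · exact congrArg Subtype.val (e.symm_apply_apply u)

/-- The basic criterion for essential self-adjointness. -/
theorem isSelfAdjoint_closure {A : H →ₗ.[ℂ] H} (hd : Dense (A.domain : Set H))
    (hs : A.IsFormalAdjoint A)
    (hr : ∀ z : ℂ, z.im ≠ 0 →
      ∀ u : H, (∀ x : A.domain, ⟪u, A x - z • (x : H)⟫_ℂ = 0) → u = 0) :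
    IsSelfAdjoint A.closure := by
  have hsc := isFormalAdjoint_closure hd hs
  have hdc : Dense (A.closure.domain : Set H) := hd.mono A.le_closure.1
  rw [LinearPMap.isSelfAdjoint_def]
  refine (LinearPMap.eq_of_le_of_domain_eq (hsc.le_adjoint hdc) ?_).symm
  refine le_antisymm (hsc.le_adjoint hdc).1 fun u hu => ?_
  have hI : (Complex.I).im ≠ 0 := by simp
  have hI' : (-Complex.I).im ≠ 0 := by simp
  -- Solving `(Ā - i) w = (Ā* - i) u` makes `u - w` an element of the kernel of `Ā* - i`, hence
  -- orthogonal to the range of `Ā + i`. That range is everything, so it contains `u - w` itself.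
  obtain ⟨w, hw⟩ := exists_closure_sub_smul_eq hd hs hI (hr _ hI)
    (A.closure.adjoint ⟨u, hu⟩ - Complex.I • u)
  have hadj := LinearPMap.adjoint_isFormalAdjoint hdc
  obtain ⟨y, hy⟩ := exists_closure_sub_smul_eq hd hs hI' (hr _ hI') (u - w)
  have h0 : ⟪u - (w : H), u - (w : H)⟫_ℂ = 0 := by
    nth_rw 2 [← hy]
    have h1 := hadj ⟨u, hu⟩ y
    have h2 := hsc w y
    have h3 : A.closure.adjoint ⟨u, hu⟩ = A.closure w - Complex.I • (w : H) + Complex.I • u := by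
      rw [hw]; abel
    rw [h3] at h1
    simp only [inner_sub_left, inner_sub_right, inner_add_left, inner_smul_left, inner_smul_right,
      Complex.conj_I] at h1 h2 ⊢
    linear_combination h2 - h1
  have huw : u = w := sub_eq_zero.1 (inner_self_eq_zero.1 h0)
  rw [huw]
  exact w.2

end FunctionalAnalysis

/-! ### Partial derivatives, the Laplacian and Green's identities. -/

section Calculus

variable {d : ℕ} {F : Type*} [NormedAddCommGroup F] [NormedSpace ℝ F]

/-- The partial derivative `∂ᵢ f`. -/
def partialDeriv (i : Fin d) (f : Space d → F) (x : Space d) : F :=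
  fderiv ℝ f x (EuclideanSpace.single i 1)

theorem contDiff_partialDeriv {f : Space d → F} (hf : ContDiff ℝ (⊤ : ℕ∞) f) (i : Fin d) :
    ContDiff ℝ (⊤ : ℕ∞) (partialDeriv i f) :=
  (hf.fderiv_right (m := (⊤ : ℕ∞)) (by simp)).clm_apply contDiff_const

theorem hasCompactSupport_partialDeriv {f : Space d → F} (hf : HasCompactSupport f) (i : Fin d) :
    HasCompactSupport (partialDeriv i f) :=
  hf.fderiv_apply ℝ _

/-- Reduces every later fact about `Δ` (smoothness, support, conjugation, rescaling, integration by
parts) to first-order partial derivatives. -/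
theorem laplacian_eq_sum_partialDeriv {f : Space d → F} (hf : ContDiff ℝ (⊤ : ℕ∞) f)
    (x : Space d) : Δ f x = ∑ i, partialDeriv i (partialDeriv i f) x := by
  rw [InnerProductSpace.laplacian_eq_iteratedFDeriv_orthonormalBasis f
    (EuclideanSpace.basisFun (Fin d) ℝ)]
  refine Finset.sum_congr rfl fun i _ => ?_
  rw [iteratedFDeriv_two_apply]
  have hd : DifferentiableAt ℝ (fderiv ℝ f) x :=
    ((hf.fderiv_right (m := (⊤ : ℕ∞)) (by simp)).differentiable (by simp)) x
  simp only [EuclideanSpace.basisFun_apply, Matrix.cons_val_zero, Matrix.cons_val_one]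
  rw [partialDeriv]
  change _ = fderiv ℝ (fun y => fderiv ℝ f y (EuclideanSpace.single i 1)) x _
  rw [fderiv_clm_apply hd (differentiableAt_const _)]
  simp

theorem contDiff_laplacian {f : Space d → F} (hf : ContDiff ℝ (⊤ : ℕ∞) f) :
    ContDiff ℝ (⊤ : ℕ∞) (Δ f) := by
  have h : Δ f = fun x => ∑ i, partialDeriv i (partialDeriv i f) x :=
    funext (laplacian_eq_sum_partialDeriv hf)
  rw [h]
  exact ContDiff.sum fun i _ => contDiff_partialDeriv (contDiff_partialDeriv hf i) i

theorem hasCompactSupport_laplacian {f : Space d → F} (hf : ContDiff ℝ (⊤ : ℕ∞) f)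
    (hfc : HasCompactSupport f) : HasCompactSupport (Δ f) := by
  have h : Δ f = fun x => ∑ i, partialDeriv i (partialDeriv i f) x :=
    funext (laplacian_eq_sum_partialDeriv hf)
  rw [h]
  refine HasCompactSupport.intro hfc fun x hx => Finset.sum_eq_zero fun i _ => ?_
  refine image_eq_zero_of_notMem_tsupport fun hmem => hx ?_
  have h1 : ∀ g : Space d → F, tsupport (partialDeriv i g) ⊆ tsupport g := fun g =>
    tsupport_fderiv_apply_subset ℝ _
  exact h1 f (h1 _ hmem)

theorem partialDeriv_comp_const_sub (i : Fin d) {f : Space d → F} (hf : ContDiff ℝ (⊤ : ℕ∞) f)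
    (a x : Space d) : partialDeriv i (fun y => f (a - y)) x = - partialDeriv i f (a - x) := by
  have h := ((hf.differentiable (by simp) (a - x)).hasFDerivAt.comp x
    ((hasFDerivAt_id x).const_sub a)).fderiv
  have h' : fderiv ℝ (fun y => f (a - y)) x =
    (fderiv ℝ f (a - x)).comp (-(ContinuousLinearMap.id ℝ (Space d))) := h
  simp [partialDeriv, h']

theorem partialDeriv_neg (i : Fin d) (f : Space d → F) (x : Space d) :
    partialDeriv i (fun y => - f y) x = - partialDeriv i f x := by
  simp [partialDeriv]

theorem laplacian_comp_const_sub {f : Space d → F} (hf : ContDiff ℝ (⊤ : ℕ∞) f)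
    (a x : Space d) : Δ (fun y => f (a - y)) x = Δ f (a - x) := by
  have hfa : ContDiff ℝ (⊤ : ℕ∞) fun y => f (a - y) := hf.comp (contDiff_const.sub contDiff_id)
  rw [laplacian_eq_sum_partialDeriv hfa, laplacian_eq_sum_partialDeriv hf]
  refine Finset.sum_congr rfl fun i _ => ?_
  rw [show partialDeriv i (fun y => f (a - y)) = fun y => - partialDeriv i f (a - y) from
    funext (partialDeriv_comp_const_sub i hf a), partialDeriv_neg,
    partialDeriv_comp_const_sub i (contDiff_partialDeriv hf i), neg_neg]

theorem integrable_of_contDiff {f : Space d → F} (hf : ContDiff ℝ (⊤ : ℕ∞) f)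
    (hfc : HasCompactSupport f) : Integrable f :=
  hf.continuous.integrable_of_hasCompactSupport hfc

/-- Green's first identity, with one compactly supported factor. -/
theorem integral_mul_laplacian {f g : Space d → ℂ} (hf : ContDiff ℝ (⊤ : ℕ∞) f)
    (hfc : HasCompactSupport f) (hg : ContDiff ℝ (⊤ : ℕ∞) g) :
    ∫ x, f x * Δ g x = - ∫ x, ∑ i, partialDeriv i f x * partialDeriv i g x := by
  have h1 : ∀ i : Fin d, Integrable fun x => f x * partialDeriv i (partialDeriv i g) x :=
    fun i => integrable_of_contDiff
      (hf.mul (contDiff_partialDeriv (contDiff_partialDeriv hg i) i)) hfc.mul_right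
  have h2 : ∀ i : Fin d, Integrable fun x => partialDeriv i f x * partialDeriv i g x :=
    fun i => integrable_of_contDiff
      ((contDiff_partialDeriv hf i).mul (contDiff_partialDeriv hg i))
      (hasCompactSupport_partialDeriv hfc i).mul_right
  simp_rw [laplacian_eq_sum_partialDeriv hg, Finset.mul_sum]
  rw [integral_finsetSum _ fun i _ => h1 i, integral_finsetSum _ fun i _ => h2 i,
    ← Finset.sum_neg_distrib]
  refine Finset.sum_congr rfl fun i _ => ?_
  exact integral_mul_fderiv_eq_neg_fderiv_mul_of_integrable (h2 i) (h1 i)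
    (integrable_of_contDiff (hf.mul (contDiff_partialDeriv hg i)) hfc.mul_right)
    (fun x _ => hf.differentiable (by simp) x)
    (fun x _ => (contDiff_partialDeriv hg i).differentiable (by simp) x)

/-- Green's second identity for compactly supported functions. -/
theorem integral_mul_laplacian_comm {f g : Space d → ℂ} (hf : ContDiff ℝ (⊤ : ℕ∞) f)
    (hfc : HasCompactSupport f) (hg : ContDiff ℝ (⊤ : ℕ∞) g) (hgc : HasCompactSupport g) :
    ∫ x, f x * Δ g x = ∫ x, Δ f x * g x := by
  rw [integral_mul_laplacian hf hfc hg]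
  simp_rw [mul_comm (Δ f _) (g _)]
  rw [integral_mul_laplacian hg hgc hf]
  simp_rw [mul_comm]

theorem partialDeriv_star (i : Fin d) {f : Space d → ℂ} (hf : ContDiff ℝ (⊤ : ℕ∞) f)
    (x : Space d) :
    partialDeriv i (fun y => (starRingEnd ℂ) (f y)) x = (starRingEnd ℂ) (partialDeriv i f x) := by
  have h := (Complex.conjCLE.toContinuousLinearMap.hasFDerivAt.comp x
    (hf.differentiable (by simp) x).hasFDerivAt).fderiv
  have h' : fderiv ℝ (fun y => (starRingEnd ℂ) (f y)) x =
    Complex.conjCLE.toContinuousLinearMap.comp (fderiv ℝ f x) := h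
  simp [partialDeriv, h']

theorem contDiff_star {f : Space d → ℂ} (hf : ContDiff ℝ (⊤ : ℕ∞) f) :
    ContDiff ℝ (⊤ : ℕ∞) fun y => (starRingEnd ℂ) (f y) :=
  Complex.conjCLE.contDiff.comp hf

theorem laplacian_star {f : Space d → ℂ} (hf : ContDiff ℝ (⊤ : ℕ∞) f) (x : Space d) :
    Δ (fun y => (starRingEnd ℂ) (f y)) x = (starRingEnd ℂ) (Δ f x) := by
  rw [laplacian_eq_sum_partialDeriv (contDiff_star hf), laplacian_eq_sum_partialDeriv hf, map_sum]
  refine Finset.sum_congr rfl fun i _ => ?_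
  rw [show partialDeriv i (fun y => (starRingEnd ℂ) (f y)) =
    fun y => (starRingEnd ℂ) (partialDeriv i f y) from funext (partialDeriv_star i hf),
    partialDeriv_star i (contDiff_partialDeriv hf i)]

theorem contDiff_ofReal {f : Space d → ℝ} (hf : ContDiff ℝ (⊤ : ℕ∞) f) :
    ContDiff ℝ (⊤ : ℕ∞) fun y => (f y : ℂ) :=
  Complex.ofRealCLM.contDiff.comp hf

theorem partialDeriv_ofReal (i : Fin d) {f : Space d → ℝ} (hf : ContDiff ℝ (⊤ : ℕ∞) f)
    (x : Space d) : partialDeriv i (fun y => (f y : ℂ)) x = ((partialDeriv i f x : ℝ) : ℂ) := by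
  have h := (Complex.ofRealCLM.hasFDerivAt.comp x
    (hf.differentiable (by simp) x).hasFDerivAt).fderiv
  have h' : fderiv ℝ (fun y => (f y : ℂ)) x = Complex.ofRealCLM.comp (fderiv ℝ f x) := h
  simp [partialDeriv, h']

theorem partialDeriv_mul (i : Fin d) {f g : Space d → ℂ} (hf : ContDiff ℝ (⊤ : ℕ∞) f)
    (hg : ContDiff ℝ (⊤ : ℕ∞) g) (x : Space d) :
    partialDeriv i (fun y => f y * g y) x = f x * partialDeriv i g x + partialDeriv i f x * g x := by
  have := fderiv_fun_mul (hf.differentiable (by simp) x) (hg.differentiable (by simp) x)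
  simp [partialDeriv, this, mul_comm]

end Calculus

/-! ### The localised energy estimate. -/

section Energy

variable {d : ℕ}

/-- A localised energy estimate for `(-Δ + V - z) v = r` with nonreal `z`. -/
theorem energy_estimate {V : Space d → ℝ} (hV : Continuous V) {z : ℂ} {v : Space d → ℂ}
    (hv : ContDiff ℝ (⊤ : ℕ∞) v) {χ : Space d → ℝ} (hχ : ContDiff ℝ (⊤ : ℕ∞) χ)
    (hχc : HasCompactSupport χ) (hχ0 : ∀ x, 0 ≤ χ x) (hχ1 : ∀ x, χ x ≤ 1) {M B κ U : ℝ}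
    (hM : ∀ i x, |partialDeriv i χ x| ≤ M) (hB : ∀ x, χ x ≠ 0 → |V x| ≤ B) (hB0 : 0 ≤ B)
    (hκ : 0 ≤ κ)
    {g : Space d → ℝ} (hg : Integrable fun x => g x ^ 2) (hgU : ∫ x, g x ^ 2 ≤ U)
    (hvg : ∀ x, ‖v x‖ ≤ g x)
    (hr : ∀ x, χ x ≠ 0 → ‖-(Δ v x) + (V x : ℂ) * v x - z * v x‖ ≤ κ * g x) {s : ℝ}
    (hs : 0 < s) :
    |z.im| * ∫ x, χ x ^ 2 * ‖v x‖ ^ 2 ≤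
      κ * U + s * (2 * (2 * d * M ^ 2 + κ + B + ‖z‖) * U) + d * M ^ 2 * U / s := by
  have hχC := contDiff_ofReal hχ
  have hχC2 : ContDiff ℝ (⊤ : ℕ∞) fun x => (χ x : ℂ) * (χ x : ℂ) := hχC.mul hχC
  have hvs := contDiff_star hv
  -- The majorant `g` replaces `‖v‖` because, for a mollification, the error in the equation is
  -- controlled by the mollified modulus and not by `‖v‖` itself.
  have hg0 : ∀ x, 0 ≤ g x := fun x => (norm_nonneg _).trans (hvg x)
  have hU0 : 0 ≤ U := (integral_nonneg fun x => sq_nonneg (g x)).trans hgU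
  have hχsq : ∀ x, χ x ^ 2 ≤ 1 := fun x => pow_le_one₀ (hχ0 x) (hχ1 x)
  have hχcs : ∀ {E : Type} [NormedAddCommGroup E] {h : Space d → E},
      (∀ x, χ x = 0 → h x = 0) → HasCompactSupport h := fun {E} _ {h} hh =>
    hχc.mono fun x hx hx0 => hx (hh x hx0)
  -- The test function `χ² v̄`. Below, `∇f · ∇v` splits into the nonnegative energy density `q` and
  -- the cross term `b`, which carries the factor `∇χ`.
  set f : Space d → ℂ := fun x => (χ x : ℂ) * (χ x : ℂ) * (starRingEnd ℂ) (v x) with hf_def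
  have hf : ContDiff ℝ (⊤ : ℕ∞) f := hχC2.mul hvs
  have hfc : HasCompactSupport f := hχcs fun x hx => by simp [hf_def, hx]
  -- the gradient terms
  set q : Space d → ℝ := fun x => ∑ i, χ x ^ 2 * ‖partialDeriv i v x‖ ^ 2 with hq_def
  set b : Space d → ℂ := fun x => ∑ i, 2 * (χ x : ℂ) * ((partialDeriv i χ x : ℝ) : ℂ) *
    (starRingEnd ℂ) (v x) * partialDeriv i v x with hb_def
  have hq : Integrable q := by
    refine Continuous.integrable_of_hasCompactSupport ?_ (hχcs fun x hx => by simp [hq_def, hx])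
    exact continuous_finsetSum _ fun i _ => (hχ.continuous.pow 2).mul
      ((contDiff_partialDeriv hv i).continuous.norm.pow 2)
  have hb : Integrable b := by
    refine Continuous.integrable_of_hasCompactSupport ?_ (hχcs fun x hx => by simp [hb_def, hx])
    refine continuous_finsetSum _ fun i _ => ?_
    exact ((continuous_const.mul hχC.continuous).mul
      (contDiff_ofReal (contDiff_partialDeriv hχ i)).continuous |>.mul hvs.continuous).mul
      (contDiff_partialDeriv hv i).continuous
  have hq0 : ∀ x, 0 ≤ q x := fun x => Finset.sum_nonneg fun i _ => by positivity
  set G := ∫ x, q x with hG_def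
  have hG0 : 0 ≤ G := integral_nonneg hq0
  have hgrad : ∀ x, ∑ i, partialDeriv i f x * partialDeriv i v x = (q x : ℂ) + b x := by
    intro x
    rw [hq_def, hb_def]
    push_cast
    rw [← Finset.sum_add_distrib]
    refine Finset.sum_congr rfl fun i _ => ?_
    rw [hf_def, partialDeriv_mul i hχC2 hvs, partialDeriv_mul i hχC hχC, partialDeriv_star i hv,
      partialDeriv_ofReal i hχ]
    have := Complex.conj_mul' (partialDeriv i v x)
    linear_combination (χ x : ℂ) ^ 2 * this
  have hgreen : ∫ x, f x * Δ v x = -((G : ℂ) + ∫ x, b x) := by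
    rw [integral_mul_laplacian hf hfc hv]
    simp_rw [hgrad]
    have hqc : Integrable fun x => (q x : ℂ) := hq.ofReal
    rw [integral_add hqc hb, integral_complex_ofReal]
  -- the bounds
  have hN : Integrable fun x => χ x ^ 2 * ‖v x‖ ^ 2 := by
    refine Continuous.integrable_of_hasCompactSupport ?_ (hχcs fun x hx => by simp [hx])
    exact (hχ.continuous.pow 2).mul (hv.continuous.norm.pow 2)
  have hVN : Integrable fun x => V x * (χ x ^ 2 * ‖v x‖ ^ 2) := by
    refine Continuous.integrable_of_hasCompactSupport ?_ (hχcs fun x hx => by simp [hx])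
    exact hV.mul ((hχ.continuous.pow 2).mul (hv.continuous.norm.pow 2))
  have hvg2 : ∀ x, χ x ^ 2 * ‖v x‖ ^ 2 ≤ g x ^ 2 := fun x => by
    calc χ x ^ 2 * ‖v x‖ ^ 2 ≤ 1 * g x ^ 2 := by
          gcongr
          · exact hχsq x
          · exact hvg x
      _ = _ := one_mul _
  set N := ∫ x, χ x ^ 2 * ‖v x‖ ^ 2 with hN_def
  have hN0 : 0 ≤ N := integral_nonneg fun x => by positivity
  have hNU : N ≤ U := (integral_mono hN hg hvg2).trans hgU
  -- Young's inequality with a free weight: `t = 1/2` lets the energy `G` absorb the cross term in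
  -- the real part, and `t = s` serves in the imaginary part.
  have hbound : ∀ t : ℝ, 0 < t → ‖∫ x, b x‖ ≤ t * G + d * M ^ 2 * U / t := by
    intro t ht
    have hpt : ∀ x, ‖b x‖ ≤ t * q x + d * M ^ 2 / t * g x ^ 2 := by
      intro x
      have hterm : ∀ i : Fin d, ‖2 * (χ x : ℂ) * ((partialDeriv i χ x : ℝ) : ℂ) *
          (starRingEnd ℂ) (v x) * partialDeriv i v x‖ ≤
          t * (χ x ^ 2 * ‖partialDeriv i v x‖ ^ 2) + M ^ 2 / t * g x ^ 2 := by
        intro i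
        simp only [norm_mul, Complex.norm_real, Real.norm_eq_abs, RCLike.norm_conj,
          Complex.norm_ofNat, abs_of_nonneg (hχ0 x)]
        have h1 : |partialDeriv i χ x| * ‖v x‖ ≤ M * g x :=
          mul_le_mul (hM i x) (hvg x) (norm_nonneg _) ((abs_nonneg _).trans (hM i x))
        have h2 : 2 * (χ x * ‖partialDeriv i v x‖) * (M * g x) ≤
            t * (χ x * ‖partialDeriv i v x‖) ^ 2 + t⁻¹ * (M * g x) ^ 2 := by
          have := sq_nonneg (t * (χ x * ‖partialDeriv i v x‖) - M * g x)
          have h3 : t⁻¹ * (t * (χ x * ‖partialDeriv i v x‖) - M * g x) ^ 2 =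
            t * (χ x * ‖partialDeriv i v x‖) ^ 2 + t⁻¹ * (M * g x) ^ 2 -
              2 * (χ x * ‖partialDeriv i v x‖) * (M * g x) := by
            field_simp
            ring
          have h4 : 0 ≤ t⁻¹ * (t * (χ x * ‖partialDeriv i v x‖) - M * g x) ^ 2 := by positivity
          linarith
        calc 2 * χ x * |partialDeriv i χ x| * ‖v x‖ * ‖partialDeriv i v x‖
            = 2 * (χ x * ‖partialDeriv i v x‖) * (|partialDeriv i χ x| * ‖v x‖) := by ring
          _ ≤ 2 * (χ x * ‖partialDeriv i v x‖) * (M * g x) := by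
              have := hχ0 x
              gcongr
          _ ≤ _ := h2
          _ = _ := by ring
      calc ‖b x‖ ≤ ∑ i : Fin d, ‖2 * (χ x : ℂ) * ((partialDeriv i χ x : ℝ) : ℂ) *
            (starRingEnd ℂ) (v x) * partialDeriv i v x‖ := norm_sum_le _ _
        _ ≤ ∑ i : Fin d, (t * (χ x ^ 2 * ‖partialDeriv i v x‖ ^ 2) + M ^ 2 / t * g x ^ 2) :=
            Finset.sum_le_sum fun i _ => hterm i
        _ = _ := by
            rw [Finset.sum_add_distrib, ← Finset.mul_sum]
            simp only [Finset.sum_const, Finset.card_univ, Fintype.card_fin, nsmul_eq_mul, hq_def]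
            ring
    calc ‖∫ x, b x‖ ≤ ∫ x, ‖b x‖ := norm_integral_le_integral_norm _
      _ ≤ ∫ x, (t * q x + d * M ^ 2 / t * g x ^ 2) :=
          integral_mono hb.norm ((hq.const_mul _).add (hg.const_mul _)) hpt
      _ = t * G + d * M ^ 2 / t * ∫ x, g x ^ 2 := by
          rw [integral_add (hq.const_mul _) (hg.const_mul _), integral_const_mul,
            integral_const_mul]
      _ ≤ t * G + d * M ^ 2 / t * U := by gcongr
      _ = _ := by ring
  have hfr : ‖∫ x, f x * (-(Δ v x) + (V x : ℂ) * v x - z * v x)‖ ≤ κ * U := by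
    calc _ ≤ ∫ x, κ * g x ^ 2 := by
          refine norm_integral_le_of_norm_le (hg.const_mul κ) (Filter.Eventually.of_forall ?_)
          intro x
          by_cases hx : χ x = 0
          · simp only [hf_def, hx]
            simpa using by positivity
          rw [norm_mul]
          have h1 : ‖f x‖ ≤ g x := by
            simp only [hf_def, norm_mul, Complex.norm_real, Real.norm_eq_abs, RCLike.norm_conj,
              abs_of_nonneg (hχ0 x)]
            calc χ x * χ x * ‖v x‖ ≤ 1 * g x := by
                  gcongr
                  · rw [← sq]; exact hχsq x
                  · exact hvg x
              _ = _ := one_mul _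
          calc _ ≤ g x * (κ * g x) := mul_le_mul h1 (hr x hx) (norm_nonneg _) (hg0 x)
            _ = _ := by ring
      _ = κ * ∫ x, g x ^ 2 := integral_const_mul _ _
      _ ≤ _ := by gcongr
  have hVB : |∫ x, V x * (χ x ^ 2 * ‖v x‖ ^ 2)| ≤ B * U := by
    calc |∫ x, V x * (χ x ^ 2 * ‖v x‖ ^ 2)| ≤ ∫ x, B * g x ^ 2 := by
          rw [← Real.norm_eq_abs]
          refine norm_integral_le_of_norm_le (hg.const_mul B) (Filter.Eventually.of_forall ?_)
          intro x
          by_cases hx : χ x = 0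
          · simp only [hx]
            simpa using by positivity
          rw [norm_mul, Real.norm_of_nonneg (by positivity : 0 ≤ χ x ^ 2 * ‖v x‖ ^ 2)]
          exact mul_le_mul (hB x hx) (hvg2 x) (by positivity) hB0
      _ = B * ∫ x, g x ^ 2 := integral_const_mul _ _
      _ ≤ _ := by gcongr
  have hmain : ∫ x, f x * (-(Δ v x) + (V x : ℂ) * v x - z * v x) =
      (G : ℂ) + (∫ x, b x) + ((∫ x, V x * (χ x ^ 2 * ‖v x‖ ^ 2) : ℝ) : ℂ) - z * (N : ℂ) := by
    have hpt : ∀ x, f x * (-(Δ v x) + (V x : ℂ) * v x - z * v x) =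
        -(f x * Δ v x) + ((V x * (χ x ^ 2 * ‖v x‖ ^ 2) : ℝ) : ℂ) -
          z * ((χ x ^ 2 * ‖v x‖ ^ 2 : ℝ) : ℂ) := by
      intro x
      have := Complex.conj_mul' (v x)
      push_cast
      rw [hf_def]
      linear_combination ((V x : ℂ) - z) * (χ x : ℂ) ^ 2 * this
    simp_rw [hpt]
    have hi1 : Integrable fun x => f x * Δ v x :=
      integrable_of_contDiff (hf.mul (contDiff_laplacian hv)) hfc.mul_right
    have hi2 : Integrable fun x => ((V x * (χ x ^ 2 * ‖v x‖ ^ 2) : ℝ) : ℂ) := hVN.ofReal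
    have hi3 : Integrable fun x => z * ((χ x ^ 2 * ‖v x‖ ^ 2 : ℝ) : ℂ) := hN.ofReal.const_mul z
    have hi4 : Integrable fun x => -(f x * Δ v x) + ((V x * (χ x ^ 2 * ‖v x‖ ^ 2) : ℝ) : ℂ) :=
      hi1.neg.add hi2
    have hi5 : Integrable fun x => -(f x * Δ v x) := hi1.neg
    rw [integral_sub hi4 hi3, integral_add hi5 hi2, integral_neg, hgreen, integral_const_mul,
      integral_complex_ofReal, integral_complex_ofReal]
    ring
  set R := ∫ x, f x * (-(Δ v x) + (V x : ℂ) * v x - z * v x) with hR_def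
  set W := ∫ x, V x * (χ x ^ 2 * ‖v x‖ ^ 2) with hW_def
  set β := ∫ x, b x with hβ_def
  -- The energy and the potential term are real, so they disappear from the imaginary part.
  have him : z.im * N = β.im - R.im := by
    rw [hmain]
    simp
  have hre : G = R.re - β.re - W + z.re * N := by
    rw [hmain]
    simp
    ring
  have hzN : z.re * N ≤ ‖z‖ * U :=
    mul_le_mul ((le_abs_self _).trans (Complex.abs_re_le_norm z)) hNU hN0 (norm_nonneg _)
  have hG : G ≤ 2 * (2 * d * M ^ 2 + κ + B + ‖z‖) * U := by
    have h1 := (Complex.abs_re_le_norm β).trans (hbound (1 / 2) (by norm_num))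
    have h2 := (Complex.abs_re_le_norm R).trans hfr
    have h3 := abs_le.1 h1
    have h4 := abs_le.1 h2
    have h5 := abs_le.1 hVB
    have h6 : d * M ^ 2 * U / (1 / 2) = 2 * (d * M ^ 2 * U) := by ring
    nlinarith
  have h1 := (Complex.abs_im_le_norm β).trans (hbound s hs)
  have h2 := (Complex.abs_im_le_norm R).trans hfr
  calc |z.im| * N = |β.im - R.im| := by rw [← him, abs_mul, abs_of_nonneg hN0]
    _ ≤ |β.im| + |R.im| := abs_sub _ _
    _ ≤ (s * G + d * M ^ 2 * U / s) + κ * U := add_le_add h1 h2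
    _ ≤ (s * (2 * (2 * d * M ^ 2 + κ + B + ‖z‖) * U) + d * M ^ 2 * U / s) + κ * U := by gcongr
    _ = _ := by ring

end Energy

/-! ### Mollified weak solutions. -/

section Mollification

open scoped Convolution

variable {d : ℕ}

theorem partialDeriv_convolution (i : Fin d) {w φ : Space d → ℂ} (hw : LocallyIntegrable w)
    (hφ : ContDiff ℝ (⊤ : ℕ∞) φ) (hφc : HasCompactSupport φ) :
    partialDeriv i (w ⋆[ContinuousLinearMap.mul ℝ ℂ] φ) =
      w ⋆[ContinuousLinearMap.mul ℝ ℂ] partialDeriv i φ := by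
  ext x
  rw [partialDeriv, (hφc.hasFDerivAt_convolution_right _ hw (hφ.of_le (by simp)) x).fderiv]
  exact convolution_precompR_apply _ hw (hφc.fderiv ℝ) (hφ.continuous_fderiv (by simp)) x _

theorem contDiff_convolution {w φ : Space d → ℂ} (hw : LocallyIntegrable w)
    (hφ : ContDiff ℝ (⊤ : ℕ∞) φ) (hφc : HasCompactSupport φ) :
    ContDiff ℝ (⊤ : ℕ∞) (w ⋆[ContinuousLinearMap.mul ℝ ℂ] φ) :=
  hφc.contDiff_convolution_right _ hw hφ

theorem integrable_mul_comp_sub {w φ : Space d → ℂ} (hw : LocallyIntegrable w)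
    (hφ : Continuous φ) (hφc : HasCompactSupport φ) (x : Space d) :
    Integrable fun t => w t * φ (x - t) :=
  hφc.convolutionExists_right (ContinuousLinearMap.mul ℝ ℂ) hw hφ x

/-- All derivatives fall on the smooth factor, so the weak equation tested with `φ (x - ·)` yields a
pointwise equation for the convolution. -/
theorem laplacian_convolution {w φ : Space d → ℂ} (hw : LocallyIntegrable w)
    (hφ : ContDiff ℝ (⊤ : ℕ∞) φ) (hφc : HasCompactSupport φ) (x : Space d) :
    Δ (w ⋆[ContinuousLinearMap.mul ℝ ℂ] φ) x = ∫ t, w t * Δ φ (x - t) := by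
  rw [laplacian_eq_sum_partialDeriv (contDiff_convolution hw hφ hφc)]
  simp_rw [laplacian_eq_sum_partialDeriv hφ, Finset.mul_sum]
  have h1 : ∀ i, HasCompactSupport (partialDeriv i (partialDeriv i φ)) := fun i =>
    hasCompactSupport_partialDeriv (hasCompactSupport_partialDeriv hφc i) i
  have h2 : ∀ i, Continuous (partialDeriv i (partialDeriv i φ)) := fun i =>
    (contDiff_partialDeriv (contDiff_partialDeriv hφ i) i).continuous
  rw [integral_finsetSum _ fun i _ => integrable_mul_comp_sub hw (h2 i) (h1 i) x]
  refine Finset.sum_congr rfl fun i _ => ?_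
  rw [partialDeriv_convolution i hw hφ hφc, partialDeriv_convolution i hw
    (contDiff_partialDeriv hφ i) (hasCompactSupport_partialDeriv hφc i)]
  rfl

/-- Averaging against a probability density does not increase the `L²` norm. -/
theorem integral_sq_convolution_le {w : Space d → ℂ} (hw : MemLp w 2) {ρ : Space d → ℝ}
    (hρ : Continuous ρ) (hρc : HasCompactSupport ρ) (hρ0 : ∀ x, 0 ≤ ρ x) (hρ1 : ∫ x, ρ x = 1) :
    Integrable (fun x => (∫ t, ‖w t‖ * ρ (x - t)) ^ 2) ∧
      ∫ x, (∫ t, ‖w t‖ * ρ (x - t)) ^ 2 ≤ ∫ x, ‖w x‖ ^ 2 := by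
  have hw2 : Integrable fun x => ‖w x‖ ^ 2 := hw.integrable_norm_pow (by simp)
  have hwl : LocallyIntegrable fun x => ‖w x‖ := hw.norm.locallyIntegrable (by simp)
  have hρi : Integrable ρ := hρ.integrable_of_hasCompactSupport hρc
  have hI1 : ∀ x, Integrable fun t => ‖w t‖ * ρ (x - t) := fun x =>
    hρc.convolutionExists_right (ContinuousLinearMap.mul ℝ ℝ) hwl hρ x
  have hI2 : ∀ x, Integrable fun t => ‖w t‖ ^ 2 * ρ (x - t) := fun x =>
    hρc.convolutionExists_right (ContinuousLinearMap.mul ℝ ℝ) hw2.locallyIntegrable hρ x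
  have hI3 : ∀ x, Integrable fun t => ρ (x - t) := fun x => hρi.comp_sub_left x
  have hint : Integrable fun x => ∫ t, ‖w t‖ ^ 2 * ρ (x - t) :=
    hw2.integrable_convolution (ContinuousLinearMap.mul ℝ ℝ) hρi
  have hval : ∫ x, ∫ t, ‖w t‖ ^ 2 * ρ (x - t) = ∫ x, ‖w x‖ ^ 2 := by
    have := integral_convolution (μ := (volume : Measure (Space d)))
      (ν := (volume : Measure (Space d))) (ContinuousLinearMap.mul ℝ ℝ) hw2 hρi
    rw [hρ1] at this
    simpa [convolution_def] using this
  have hpt : ∀ x, (∫ t, ‖w t‖ * ρ (x - t)) ^ 2 ≤ ∫ t, ‖w t‖ ^ 2 * ρ (x - t) := by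
    intro x
    set m := ∫ t, ‖w t‖ * ρ (x - t) with hm
    -- Jensen's inequality, as nonnegativity of the variance of `‖w‖` under the density `ρ (x - ·)`,
    -- whose mean is `m`.
    have h0 : 0 ≤ ∫ t, (‖w t‖ - m) ^ 2 * ρ (x - t) :=
      integral_nonneg fun t => mul_nonneg (sq_nonneg _) (hρ0 _)
    have hexp : ∀ t, (‖w t‖ - m) ^ 2 * ρ (x - t) =
        ‖w t‖ ^ 2 * ρ (x - t) - 2 * m * (‖w t‖ * ρ (x - t)) + m ^ 2 * ρ (x - t) := fun t => by ring
    have h1 : ∫ t, ρ (x - t) = 1 := by rw [integral_sub_left_eq_self, hρ1]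
    simp_rw [hexp] at h0
    have hs : Integrable fun t => ‖w t‖ ^ 2 * ρ (x - t) - 2 * m * (‖w t‖ * ρ (x - t)) :=
      (hI2 x).sub ((hI1 x).const_mul _)
    rw [integral_add hs ((hI3 x).const_mul _), integral_sub (hI2 x) ((hI1 x).const_mul _),
      integral_const_mul, integral_const_mul, h1, ← hm] at h0
    linarith
  have hcont : Continuous fun x => ∫ t, ‖w t‖ * ρ (x - t) :=
    hρc.continuous_convolution_right (ContinuousLinearMap.mul ℝ ℝ) hwl hρ
  have hint' : Integrable fun x => (∫ t, ‖w t‖ * ρ (x - t)) ^ 2 :=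
    hint.mono' (hcont.pow 2).aestronglyMeasurable (Filter.Eventually.of_forall fun x => by
      rw [Real.norm_of_nonneg (sq_nonneg _)]
      exact hpt x)
  exact ⟨hint', (integral_mono hint' hint hpt).trans hval.le⟩

/-- The energy estimate applied to the mollification of a weak solution. -/
theorem mollified_estimate {V : Space d → ℝ} (hV : Continuous V) {z : ℂ} {w : Space d → ℂ}
    (hw : MemLp w 2)
    (hweak : ∀ φ : Space d → ℂ, ContDiff ℝ (⊤ : ℕ∞) φ → HasCompactSupport φ →
      ∫ x, w x * (-(Δ φ x) + (V x : ℂ) * φ x - z * φ x) = 0)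
    {χ : Space d → ℝ} (hχ : ContDiff ℝ (⊤ : ℕ∞) χ)
    (hχc : HasCompactSupport χ) (hχ0 : ∀ x, 0 ≤ χ x) (hχ1 : ∀ x, χ x ≤ 1) {M B κ : ℝ}
    (hM : ∀ i x, |partialDeriv i χ x| ≤ M) (hB : ∀ x, χ x ≠ 0 → |V x| ≤ B) (hB0 : 0 ≤ B)
    (hκ : 0 ≤ κ) {ρ : Space d → ℝ} (hρ : ContDiff ℝ (⊤ : ℕ∞) ρ) (hρc : HasCompactSupport ρ)
    (hρ0 : ∀ x, 0 ≤ ρ x) (hρ1 : ∫ x, ρ x = 1)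
    (hκρ : ∀ x t, χ x ≠ 0 → ρ (x - t) ≠ 0 → |V x - V t| ≤ κ) {s : ℝ} (hs : 0 < s) :
    |z.im| * ∫ x, χ x ^ 2 * ‖∫ t, w t * (ρ (x - t) : ℂ)‖ ^ 2 ≤
      κ * (∫ x, ‖w x‖ ^ 2) + s * (2 * (2 * d * M ^ 2 + κ + B + ‖z‖) * ∫ x, ‖w x‖ ^ 2) +
        d * M ^ 2 * (∫ x, ‖w x‖ ^ 2) / s := by
  have hwl : LocallyIntegrable w := hw.locallyIntegrable (by simp)
  set φ : Space d → ℂ := fun x => (ρ x : ℂ) with hφ_def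
  have hφ : ContDiff ℝ (⊤ : ℕ∞) φ := contDiff_ofReal hρ
  have hφc : HasCompactSupport φ := hρc.comp_left Complex.ofReal_zero
  obtain ⟨hgi, hgU⟩ := integral_sq_convolution_le hw hρ.continuous hρc hρ0 hρ1
  have hI1 : ∀ x, Integrable fun t => ‖w t‖ * ρ (x - t) := fun x =>
    hρc.convolutionExists_right (ContinuousLinearMap.mul ℝ ℝ) (hw.norm.locallyIntegrable (by simp)) hρ.continuous x
  have hΔφ : Continuous (Δ φ) := (contDiff_laplacian hφ).continuous
  have hΔφc := hasCompactSupport_laplacian hφ hφc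
  refine energy_estimate hV (contDiff_convolution hwl hφ hφc) hχ hχc hχ0 hχ1 hM hB hB0 hκ hgi hgU
    (fun x => ?_) (fun x hx => ?_) hs
  · refine (norm_integral_le_integral_norm _).trans (le_of_eq ?_)
    refine integral_congr_ae (Filter.Eventually.of_forall fun t => ?_)
    simp [hφ_def, abs_of_nonneg (hρ0 _)]
  · have hw0 := hweak (fun t => φ (x - t)) (hφ.comp (contDiff_const.sub contDiff_id))
      (hφc.comp_homeomorph (Homeomorph.subLeft x))
    have hi1 := integrable_mul_comp_sub hwl hΔφ hΔφc x
    have hi2 := integrable_mul_comp_sub hwl hφ.continuous hφc x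
    have hi3 : Integrable fun t => w t * ((V t : ℂ) * φ (x - t)) := by
      have hVφ : Continuous fun t => (V t : ℂ) * φ (x - t) :=
        (Complex.continuous_ofReal.comp hV).mul (hφ.continuous.comp (continuous_const.sub
          continuous_id))
      have hc : HasCompactSupport fun t => (V t : ℂ) * φ (x - t) :=
        (hφc.comp_homeomorph (Homeomorph.subLeft x)).mul_left
      simpa only [smul_eq_mul] using hwl.integrable_smul_right_of_hasCompactSupport hVφ hc
    have hexp : ∀ t, w t * (-(Δ (fun t => φ (x - t)) t) + (V t : ℂ) * φ (x - t) - z * φ (x - t)) =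
        -(w t * Δ φ (x - t)) + w t * ((V t : ℂ) * φ (x - t)) - z * (w t * φ (x - t)) := fun t => by
      rw [laplacian_comp_const_sub hφ]; ring
    simp_rw [hexp] at hw0
    have hi4 : Integrable fun t => -(w t * Δ φ (x - t)) := hi1.neg
    have hi5 : Integrable fun t => -(w t * Δ φ (x - t)) + w t * ((V t : ℂ) * φ (x - t)) :=
      hi4.add hi3
    rw [integral_sub hi5 (hi2.const_mul z), integral_add hi4 hi3, integral_neg,
      integral_const_mul] at hw0
    -- The mollification fails to solve the equation only by the commutator of convolution with
    -- multiplication by `V`, which the oscillation `κ` of `V` controls.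
    have hcomm : -(Δ (w ⋆[ContinuousLinearMap.mul ℝ ℂ] φ) x) +
        (V x : ℂ) * (w ⋆[ContinuousLinearMap.mul ℝ ℂ] φ) x -
        z * (w ⋆[ContinuousLinearMap.mul ℝ ℂ] φ) x =
        ∫ t, ((V x : ℂ) * (w t * φ (x - t)) - w t * ((V t : ℂ) * φ (x - t))) := by
      rw [laplacian_convolution hwl hφ hφc, integral_sub (hi2.const_mul _) hi3,
        integral_const_mul]
      have : (w ⋆[ContinuousLinearMap.mul ℝ ℂ] φ) x = ∫ t, w t * φ (x - t) := rfl
      rw [this]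
      linear_combination hw0
    rw [hcomm]
    calc _ ≤ ∫ t, κ * (‖w t‖ * ρ (x - t)) := by
          refine norm_integral_le_of_norm_le ((hI1 x).const_mul κ)
            (Filter.Eventually.of_forall fun t => ?_)
          have h1 : (V x : ℂ) * (w t * φ (x - t)) - w t * ((V t : ℂ) * φ (x - t)) =
              ((V x - V t : ℝ) : ℂ) * (w t * φ (x - t)) := by push_cast; ring
          rw [h1, norm_mul, norm_mul, Complex.norm_real, Complex.norm_real, Real.norm_eq_abs,
            Real.norm_of_nonneg (hρ0 _)]
          by_cases hρt : ρ (x - t) = 0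
          · simp [hρt]
          · have := hκρ x t hx hρt
            have := hρ0 (x - t)
            gcongr
      _ = _ := integral_const_mul _ _

end Mollification

/-! ### Vanishing of weak `L²` solutions. -/

section Uniqueness

open Filter Topology
open scoped Convolution

variable {d : ℕ}

theorem partialDeriv_comp_smul (i : Fin d) {F : Type*} [NormedAddCommGroup F] [NormedSpace ℝ F]
    {f : Space d → F} (hf : ContDiff ℝ (⊤ : ℕ∞) f) (c : ℝ) (x : Space d) :
    partialDeriv i (fun y => f (c • y)) x = c • partialDeriv i f (c • x) := by
  have h := ((hf.differentiable (by simp) (c • x)).hasFDerivAt.comp x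
    ((hasFDerivAt_id x).const_smul c)).fderiv
  have h' : fderiv ℝ (fun y => f (c • y)) x =
    (fderiv ℝ f (c • x)).comp (c • (ContinuousLinearMap.id ℝ (Space d))) := h
  simp [partialDeriv, h']

/-- Smooth cutoffs at scale `R`, with the natural bounds on their derivatives. -/
theorem exists_cutoff (d : ℕ) : ∃ M : ℝ, 0 ≤ M ∧ ∀ R : ℝ, 0 < R → ∃ χ : Space d → ℝ,
    ContDiff ℝ (⊤ : ℕ∞) χ ∧ HasCompactSupport χ ∧ (∀ x, 0 ≤ χ x) ∧ (∀ x, χ x ≤ 1) ∧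
    (∀ x, ‖x‖ ≤ R → χ x = 1) ∧ (∀ x, χ x ≠ 0 → ‖x‖ < 2 * R) ∧
    (∀ i x, |partialDeriv i χ x| ≤ M / R) ∧ (∀ x, |Δ χ x| ≤ M / R ^ 2) := by
  let χ₀ : ContDiffBump (0 : Space d) := ⟨1, 2, one_pos, one_lt_two⟩
  have h0 : ContDiff ℝ (⊤ : ℕ∞) χ₀ := χ₀.contDiff
  have h0c : HasCompactSupport χ₀ := χ₀.hasCompactSupport
  have hb1 : ∀ i, ∃ C, ∀ x, ‖partialDeriv i χ₀ x‖ ≤ C := fun i =>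
    (contDiff_partialDeriv h0 i).continuous.bounded_above_of_compact_support
      (hasCompactSupport_partialDeriv h0c i)
  choose C hC using hb1
  obtain ⟨D, hD⟩ := (contDiff_laplacian h0).continuous.bounded_above_of_compact_support
    (hasCompactSupport_laplacian h0 h0c)
  have hC0 : ∀ i, 0 ≤ C i := fun i => (norm_nonneg _).trans (hC i 0)
  have hD0 : 0 ≤ D := (norm_nonneg _).trans (hD 0)
  have hCs : ∀ i, C i ≤ D + ∑ j, C j := fun i =>
    (Finset.single_le_sum (fun j _ => hC0 j) (Finset.mem_univ i)).trans (by linarith)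
  have hS : 0 ≤ ∑ j, C j := Finset.sum_nonneg fun j _ => hC0 j
  refine ⟨D + ∑ j, C j, by linarith, fun R hR => ?_⟩
  have hsm : ContDiff ℝ (⊤ : ℕ∞) fun x : Space d => χ₀ (R⁻¹ • x) :=
    h0.comp (contDiff_id.const_smul _)
  refine ⟨fun x => χ₀ (R⁻¹ • x), hsm, ?_, fun x => χ₀.nonneg, fun x => χ₀.le_one,
    fun x hx => χ₀.one_of_mem_closedBall ?_, fun x hx => ?_, fun i x => ?_, fun x => ?_⟩
  · exact h0c.comp_smul (inv_ne_zero hR.ne')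
  · rw [mem_closedBall_zero_iff, norm_smul, norm_inv, Real.norm_of_nonneg hR.le,
      inv_mul_le_iff₀ hR]
    simpa [χ₀] using hx
  · have hmem : R⁻¹ • x ∈ Function.support χ₀ := hx
    rw [χ₀.support_eq, mem_ball_zero_iff, norm_smul, norm_inv, Real.norm_of_nonneg hR.le,
      inv_mul_lt_iff₀ hR] at hmem
    simpa [χ₀, mul_comm] using hmem
  · rw [partialDeriv_comp_smul i h0, smul_eq_mul, abs_mul, abs_of_pos (inv_pos.2 hR),
      inv_mul_eq_div]
    gcongr
    exact (hC i _).trans (hCs i)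
  · have hlap : Δ (fun x : Space d => χ₀ (R⁻¹ • x)) x = (R ^ 2)⁻¹ * Δ (χ₀ : Space d → ℝ) (R⁻¹ • x) := by
      rw [laplacian_eq_sum_partialDeriv hsm, laplacian_eq_sum_partialDeriv h0, Finset.mul_sum]
      refine Finset.sum_congr rfl fun i _ => ?_
      rw [show partialDeriv i (fun x : Space d => χ₀ (R⁻¹ • x)) =
        fun x => (fun y => R⁻¹ • partialDeriv i χ₀ y) (R⁻¹ • x) from
        funext fun x => partialDeriv_comp_smul i h0 R⁻¹ x,
        partialDeriv_comp_smul i ((contDiff_partialDeriv h0 i).const_smul _)]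
      have : partialDeriv i (fun y => R⁻¹ • partialDeriv i χ₀ y) (R⁻¹ • x) =
          R⁻¹ • partialDeriv i (partialDeriv i χ₀) (R⁻¹ • x) := by
        rw [partialDeriv, fderiv_fun_const_smul
          ((contDiff_partialDeriv h0 i).differentiable (by simp) _)]
        rfl
      rw [this, smul_smul, smul_eq_mul, ← mul_inv, sq]
    rw [hlap, abs_mul, abs_of_pos (by positivity), inv_mul_eq_div]
    gcongr
    exact (hD _).trans (by linarith)

/-- Weak solutions of `(-Δ + V - z) w = 0` satisfy the localised energy estimate. -/
theorem weak_estimate {V : Space d → ℝ} (hV : Continuous V) {z : ℂ} (hz : z.im ≠ 0)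
    {w : Space d → ℂ} (hw : MemLp w 2)
    (hweak : ∀ φ : Space d → ℂ, ContDiff ℝ (⊤ : ℕ∞) φ → HasCompactSupport φ →
      ∫ x, w x * (-(Δ φ x) + (V x : ℂ) * φ x - z * φ x) = 0)
    {χ : Space d → ℝ} (hχ : ContDiff ℝ (⊤ : ℕ∞) χ)
    (hχc : HasCompactSupport χ) (hχ0 : ∀ x, 0 ≤ χ x) (hχ1 : ∀ x, χ x ≤ 1) {M B : ℝ}
    (hM : ∀ i x, |partialDeriv i χ x| ≤ M) (hB : ∀ x, χ x ≠ 0 → |V x| ≤ B) (hB0 : 0 ≤ B)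
    {s : ℝ} (hs : 0 < s) :
    |z.im| * ∫ x, χ x ^ 2 * ‖w x‖ ^ 2 ≤
      s * (2 * (2 * d * M ^ 2 + B + ‖z‖) * ∫ x, ‖w x‖ ^ 2) +
        d * M ^ 2 * (∫ x, ‖w x‖ ^ 2) / s := by
  have hwl : LocallyIntegrable w := hw.locallyIntegrable (by simp)
  set U := ∫ x, ‖w x‖ ^ 2 with hU
  have hU0 : 0 ≤ U := integral_nonneg fun x => sq_nonneg _
  -- The ratio of outer to inner radius stays equal to 2, as almost everywhere convergence of the
  -- mollifications requires.
  let φ : ℕ → ContDiffBump (0 : Space d) := fun n =>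
    ⟨1 / (n + 1 : ℝ) / 2, 1 / (n + 1 : ℝ), by positivity, half_lt_self (by positivity)⟩
  have hφ0 : Tendsto (fun n => (φ n).rOut) atTop (𝓝 0) := tendsto_one_div_add_atTop_nhds_zero_nat
  set ρ : ℕ → Space d → ℝ := fun n => (φ n).normed volume with hρ_def
  set v : ℕ → Space d → ℂ := fun n x => ∫ t, w t * (ρ n (x - t) : ℂ) with hv_def
  have hρ : ∀ n, ContDiff ℝ (⊤ : ℕ∞) (ρ n) := fun n => (φ n).contDiff_normed
  have hρc : ∀ n, HasCompactSupport (ρ n) := fun n => (φ n).hasCompactSupport_normed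
  have hlim : ∀ᵐ x, Tendsto (fun n => v n x) atTop (𝓝 (w x)) := by
    have := ContDiffBump.ae_convolution_tendsto_right_of_locallyIntegrable (φ := φ) (l := atTop)
      (K := 2) (μ := volume) hφ0 (Eventually.of_forall fun n => by simp [φ]; ring_nf; rfl) hwl
    filter_upwards [this] with x hx
    refine hx.congr fun n => ?_
    rw [convolution_lsmul_swap]
    refine integral_congr_ae (Eventually.of_forall fun t => ?_)
    simp [hρ_def, mul_comm]
  have hvc : ∀ n, Continuous (v n) := fun n =>
    (contDiff_convolution hwl (contDiff_ofReal (hρ n))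
      ((hρc n).comp_left Complex.ofReal_zero)).continuous
  have hNi : Integrable fun x => χ x ^ 2 * ‖w x‖ ^ 2 := by
    have hw2 : Integrable fun x => ‖w x‖ ^ 2 := hw.integrable_norm_pow (by simp)
    refine hw2.mono' ((hχ.continuous.pow 2).aestronglyMeasurable.mul
      hw2.aestronglyMeasurable) (Eventually.of_forall fun x => ?_)
    rw [Real.norm_of_nonneg (by positivity)]
    exact mul_le_of_le_one_left (by positivity) (pow_le_one₀ (hχ0 x) (hχ1 x))
  -- Here `κ` bounds the oscillation of `V` at the mollification scale near the support of `χ`.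
  -- Uniform continuity there makes any positive value admissible.
  have hkey : ∀ κ > 0, |z.im| * ∫ x, χ x ^ 2 * ‖w x‖ ^ 2 ≤
      κ * U + s * (2 * (2 * d * M ^ 2 + κ + B + ‖z‖) * U) + d * M ^ 2 * U / s := by
    intro κ hκ
    set E := κ * U + s * (2 * (2 * d * M ^ 2 + κ + B + ‖z‖) * U) + d * M ^ 2 * U / s with hE
    have hE0 : 0 ≤ E := by positivity
    have hev : ∀ᶠ n in atTop, |z.im| * ∫ x, χ x ^ 2 * ‖v n x‖ ^ 2 ≤ E := by
      have huc := hχc.isCompact.uniformContinuousAt_of_continuousAt V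
        (fun x _ => hV.continuousAt) (Metric.dist_mem_uniformity hκ)
      obtain ⟨η, hη, hηκ⟩ := Metric.mem_uniformity_dist.1 huc
      filter_upwards [hφ0.eventually (gt_mem_nhds hη)] with n hn
      refine mollified_estimate hV hw hweak hχ hχc hχ0 hχ1 hM hB hB0 hκ.le (hρ n) (hρc n)
        (φ n).nonneg_normed (φ n).integral_normed (fun x t hx hρt => ?_) hs
      have hmem : x - t ∈ Function.support (ρ n) := hρt
      rw [hρ_def, (φ n).support_normed_eq, mem_ball_zero_iff, ← dist_eq_norm] at hmem
      have := hηκ (hmem.trans hn) (subset_tsupport χ hx)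
      exact (le_of_lt this)
    -- Only almost everywhere convergence is known, and Fatou's lemma gives the needed direction.
    have hfatou : ∫⁻ x, ENNReal.ofReal (χ x ^ 2 * ‖w x‖ ^ 2) ≤ ENNReal.ofReal (E / |z.im|) := by
      calc ∫⁻ x, ENNReal.ofReal (χ x ^ 2 * ‖w x‖ ^ 2)
          = ∫⁻ x, liminf (fun n => ENNReal.ofReal (χ x ^ 2 * ‖v n x‖ ^ 2)) atTop := by
            refine lintegral_congr_ae ?_
            filter_upwards [hlim] with x hx
            exact ((ENNReal.continuous_ofReal.tendsto _).comp
              ((hx.norm.pow 2).const_mul (χ x ^ 2))).liminf_eq.symm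
        _ ≤ liminf (fun n => ∫⁻ x, ENNReal.ofReal (χ x ^ 2 * ‖v n x‖ ^ 2)) atTop := by
            refine lintegral_liminf_le fun n => ?_
            exact (ENNReal.continuous_ofReal.comp
              ((hχ.continuous.pow 2).mul ((hvc n).norm.pow 2))).measurable
        _ ≤ ENNReal.ofReal (E / |z.im|) := by
            refine liminf_le_of_frequently_le' (Eventually.frequently ?_)
            filter_upwards [hev] with n hn
            rw [← ofReal_integral_eq_lintegral_ofReal]
            · refine ENNReal.ofReal_le_ofReal ?_
              rw [le_div_iff₀ (abs_pos.2 hz), mul_comm]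
              exact hn
            · refine Continuous.integrable_of_hasCompactSupport
                ((hχ.continuous.pow 2).mul ((hvc n).norm.pow 2)) ?_
              exact hχc.mono fun x hx hx0 => hx (by simp [hx0])
            · exact Eventually.of_forall fun x => by positivity
    rw [← ofReal_integral_eq_lintegral_ofReal hNi (Eventually.of_forall fun x => by positivity),
      ENNReal.ofReal_le_ofReal_iff (by positivity), le_div_iff₀ (abs_pos.2 hz), mul_comm] at hfatou
    exact hfatou
  refine le_of_forall_pos_le_add fun e he => ?_
  -- `U + 2 s U` is the total coefficient of `κ`; the added one keeps the divisor positive.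
  have hA : 0 < U + 2 * s * U + 1 := by positivity
  refine (hkey (e / (U + 2 * s * U + 1)) (by positivity)).trans ?_
  have h1 : e / (U + 2 * s * U + 1) * (U + 2 * s * U) ≤ e := by
    rw [div_mul_eq_mul_div, div_le_iff₀ hA]
    nlinarith
  nlinarith

/-- For potentials of at most linear growth, the equation `(-Δ + V - z) w = 0` with nonreal `z` has
no nontrivial weak solution in `L²`. -/
theorem weak_solution_eq_zero {V : Space d → ℝ} (hV : Continuous V) {c : ℝ}
    (hc : ∀ x, |V x| ≤ c * (1 + ‖x‖)) {z : ℂ} (hz : z.im ≠ 0)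
    {w : Space d → ℂ} (hw : MemLp w 2)
    (hweak : ∀ φ : Space d → ℂ, ContDiff ℝ (⊤ : ℕ∞) φ → HasCompactSupport φ →
      ∫ x, w x * (-(Δ φ x) + (V x : ℂ) * φ x - z * φ x) = 0) : w =ᵐ[volume] 0 := by
  have hc0 : 0 ≤ c := by
    have := (abs_nonneg _).trans (hc 0)
    simpa using this
  obtain ⟨M, hM0, hcut⟩ := exists_cutoff d
  set U := ∫ x, ‖w x‖ ^ 2 with hU
  have hU0 : 0 ≤ U := integral_nonneg fun x => sq_nonneg _
  have hw2 : Integrable fun x => ‖w x‖ ^ 2 := hw.integrable_norm_pow (by simp)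
  set K := 2 * (2 * d * M ^ 2 + 3 * c + ‖z‖) * U + d * M ^ 2 * U with hK
  have hball : ∀ n : ℕ, 1 ≤ n →
      |z.im| * ∫ x in Metric.closedBall (0 : Space d) ((n : ℝ) ^ 2), ‖w x‖ ^ 2 ≤ K / n := by
    intro n hn
    have hn1 : (1 : ℝ) ≤ n := by exact_mod_cast hn
    have hn0 : (0 : ℝ) < n := by linarith
    obtain ⟨χ, hχ, hχc, hχ0, hχ1, hχR, hχ2R, hχM, -⟩ := hcut ((n : ℝ) ^ 2) (by positivity)
    have hest := weak_estimate hV hz hw hweak hχ hχc hχ0 hχ1 hχM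
      -- At radius `n²` the potential is `O(n²)` and the cutoff gradient is `O(n⁻²)`. With `s = n⁻³`
      -- both `s B` and `M² / s` become `O(1 / n)`.
      (B := c * (1 + 2 * (n : ℝ) ^ 2)) (fun x hx => (hc x).trans (by
        have := hχ2R x hx
        gcongr)) (by positivity) (s := ((n : ℝ) ^ 3)⁻¹) (by positivity)
    have hle : ∫ x in Metric.closedBall (0 : Space d) ((n : ℝ) ^ 2), ‖w x‖ ^ 2 ≤
        ∫ x, χ x ^ 2 * ‖w x‖ ^ 2 := by
      rw [← integral_indicator measurableSet_closedBall]
      refine integral_mono_of_nonneg (Eventually.of_forall fun x => ?_) ?_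
        (Eventually.of_forall fun x => ?_)
      · exact Set.indicator_nonneg (fun _ _ => sq_nonneg _) x
      · refine hw2.mono' ((hχ.continuous.pow 2).aestronglyMeasurable.mul
          hw2.aestronglyMeasurable) (Eventually.of_forall fun x => ?_)
        rw [Real.norm_of_nonneg (by positivity)]
        exact mul_le_of_le_one_left (by positivity) (pow_le_one₀ (hχ0 x) (hχ1 x))
      · by_cases hx : x ∈ Metric.closedBall (0 : Space d) ((n : ℝ) ^ 2)
        · rw [Set.indicator_of_mem hx]
          simp [hχR x (mem_closedBall_zero_iff.1 hx)]
        · rw [Set.indicator_of_notMem hx]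
          positivity
    refine (mul_le_mul_of_nonneg_left hle (abs_nonneg _)).trans (hest.trans ?_)
    rw [← hU]
    have e1 : d * (M / (n : ℝ) ^ 2) ^ 2 * U / ((n : ℝ) ^ 3)⁻¹ = d * M ^ 2 * U / n := by
      field_simp
    have e2 : ((n : ℝ) ^ 3)⁻¹ * (2 * (2 * d * (M / (n : ℝ) ^ 2) ^ 2 +
        c * (1 + 2 * (n : ℝ) ^ 2) + ‖z‖) * U) ≤
        2 * (2 * d * M ^ 2 + 3 * c + ‖z‖) * U / n := by
      have hn2 : (1 : ℝ) ≤ (n : ℝ) ^ 2 := one_le_pow₀ hn1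
      have a1 : (M / (n : ℝ) ^ 2) ^ 2 ≤ (n : ℝ) ^ 2 * M ^ 2 := by
        have : M / (n : ℝ) ^ 2 ≤ M := div_le_self hM0 hn2
        calc (M / (n : ℝ) ^ 2) ^ 2 ≤ M ^ 2 := by gcongr
          _ ≤ _ := le_mul_of_one_le_left (sq_nonneg M) hn2
      have a2 : c * (1 + 2 * (n : ℝ) ^ 2) ≤ (n : ℝ) ^ 2 * (3 * c) := by nlinarith
      have a3 : ‖z‖ ≤ (n : ℝ) ^ 2 * ‖z‖ := le_mul_of_one_le_left (norm_nonneg z) hn2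
      calc _ ≤ ((n : ℝ) ^ 3)⁻¹ * (2 * (2 * d * ((n : ℝ) ^ 2 * M ^ 2) +
            (n : ℝ) ^ 2 * (3 * c) + (n : ℝ) ^ 2 * ‖z‖) * U) := by gcongr
        _ = _ := by field_simp
    rw [e1, hK, add_div]
    exact add_le_add e2 le_rfl
  have hzero : ∀ m : ℕ, 1 ≤ m →
      ∫ x in Metric.closedBall (0 : Space d) ((m : ℝ) ^ 2), ‖w x‖ ^ 2 = 0 := by
    intro m hm
    refine le_antisymm ?_ (integral_nonneg fun x => sq_nonneg _)
    -- The mass of a fixed ball is at most that of every larger one, and so is bounded by a multiple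
    -- of `K / n → 0`.
    have hlim : Tendsto (fun n : ℕ => K / n) atTop (𝓝 0) := tendsto_const_div_atTop_nhds_zero_nat K
    have : |z.im| * ∫ x in Metric.closedBall (0 : Space d) ((m : ℝ) ^ 2), ‖w x‖ ^ 2 ≤ 0 := by
      refine ge_of_tendsto hlim ?_
      filter_upwards [eventually_ge_atTop m] with n hn
      refine le_trans ?_ (hball n (hm.trans hn))
      refine mul_le_mul_of_nonneg_left ?_ (abs_nonneg _)
      refine setIntegral_mono_set hw2.integrableOn (Eventually.of_forall fun x => sq_nonneg _) ?_
      refine LE.le.eventuallyLE (Metric.closedBall_subset_closedBall ?_)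
      gcongr
    exact nonpos_of_mul_nonpos_right this (abs_pos.2 hz)
  have hae : ∀ m : ℕ, ∀ᵐ x, x ∈ Metric.closedBall (0 : Space d) (((m + 1 : ℕ) : ℝ) ^ 2) → w x = 0 := by
    intro m
    rw [← ae_restrict_iff' measurableSet_closedBall]
    have := (integral_eq_zero_iff_of_nonneg (fun x => sq_nonneg ‖w x‖) hw2.integrableOn).1
      (hzero (m + 1) (by omega))
    filter_upwards [this] with x hx
    simpa using hx
  filter_upwards [ae_all_iff.2 hae] with x hx
  obtain ⟨m, hm⟩ := exists_nat_ge ‖x‖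
  refine hx m (mem_closedBall_zero_iff.2 (hm.trans ?_))
  push_cast
  nlinarith [(Nat.cast_nonneg m : (0 : ℝ) ≤ m)]

end Uniqueness

/-! ### Deterministic Schrödinger operators: self-adjointness and spectrum. -/

section Schrodinger

open Filter Topology
open scoped InnerProductSpace

variable {d : ℕ}

theorem graph_minimalOperator (V : Space d → ℝ) :
    (minimalOperator V).graph = schrodingerGraph V :=
  Submodule.toLinearPMap_graph_eq _ (schrodingerGraph_single_valued V)

theorem exists_testFunction {V : Space d → ℝ} (x : (minimalOperator V).domain) :
    ∃ φ : Space d → ℂ, ContDiff ℝ (⊤ : ℕ∞) φ ∧ HasCompactSupport φ ∧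
      ((x : L2 d) : Space d → ℂ) =ᵐ[volume] φ ∧
      (minimalOperator V x : Space d → ℂ) =ᵐ[volume] fun x => -(Δ φ x) + (V x : ℂ) * φ x := by
  have h := LinearPMap.mem_graph _ x
  rw [graph_minimalOperator] at h
  exact h

/-- For continuous `V` the image of a test function is continuous with compact support, hence in
`L²`, so no test function is lost from the domain. -/
theorem exists_mem_domain {V : Space d → ℝ} (hV : Continuous V) {φ : Space d → ℂ}
    (hφ : ContDiff ℝ (⊤ : ℕ∞) φ) (hφc : HasCompactSupport φ) :
    ∃ x : (minimalOperator V).domain, ((x : L2 d) : Space d → ℂ) =ᵐ[volume] φ ∧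
      (minimalOperator V x : Space d → ℂ) =ᵐ[volume] fun x => -(Δ φ x) + (V x : ℂ) * φ x := by
  have h1 : MemLp φ 2 volume := hφ.continuous.memLp_of_hasCompactSupport hφc
  have hc : Continuous fun x => -(Δ φ x) + (V x : ℂ) * φ x :=
    (contDiff_laplacian hφ).continuous.neg.add
      ((Complex.continuous_ofReal.comp hV).mul hφ.continuous)
  have hcs : HasCompactSupport fun x => -(Δ φ x) + (V x : ℂ) * φ x :=
    (hasCompactSupport_laplacian hφ hφc).neg.add hφc.mul_left
  have h2 : MemLp (fun x => -(Δ φ x) + (V x : ℂ) * φ x) 2 volume :=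
    hc.memLp_of_hasCompactSupport hcs
  have hmem : (h1.toLp φ, h2.toLp _) ∈ (minimalOperator V).graph := by
    rw [graph_minimalOperator]
    exact ⟨φ, hφ, hφc, h1.coeFn_toLp, h2.coeFn_toLp⟩
  obtain ⟨x, hx1, hx2⟩ := (LinearPMap.mem_graph_iff _).1 hmem
  refine ⟨x, ?_, ?_⟩
  · rw [hx1]; exact h1.coeFn_toLp
  · rw [hx2]; exact h2.coeFn_toLp

theorem dense_domain_minimalOperator {V : Space d → ℝ} (hV : Continuous V) :
    Dense ((minimalOperator V).domain : Set (L2 d)) := by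
  have := Lp.dense_hasCompactSupport_contDiff (F := ℂ) (E := Space d) (μ := volume) (p := 2)
    (by simp)
  refine this.mono fun f hf => ?_
  obtain ⟨g, hfg, hgc, hg⟩ := hf
  obtain ⟨x, hx, -⟩ := exists_mem_domain hV hg hgc
  have : (x : L2 d) = f := Lp.ext (hx.trans hfg.symm)
  rw [← this]
  exact x.2

/-- Green's second identity for `φ̄` and `ψ`, together with the reality of `V`. -/
theorem isFormalAdjoint_minimalOperator {V : Space d → ℝ} (hV : Continuous V) :
    (minimalOperator V).IsFormalAdjoint (minimalOperator V) := by
  intro x y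
  obtain ⟨φ, hφ, hφc, hx1, hx2⟩ := exists_testFunction x
  obtain ⟨ψ, hψ, hψc, hy1, hy2⟩ := exists_testFunction y
  have hφs := contDiff_star hφ
  have hφsc : HasCompactSupport fun y => (starRingEnd ℂ) (φ y) := hφc.comp_left (map_zero _)
  have hVC : Continuous fun x => (V x : ℂ) := Complex.continuous_ofReal.comp hV
  have hi1 : Integrable fun x => Δ (fun y => (starRingEnd ℂ) (φ y)) x * ψ x :=
    integrable_of_contDiff ((contDiff_laplacian hφs).mul hψ) hψc.mul_left
  have hi2 : Integrable fun x => (starRingEnd ℂ) (φ x) * Δ ψ x :=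
    integrable_of_contDiff (hφs.mul (contDiff_laplacian hψ)) hφsc.mul_right
  have hi3 : Integrable fun x => (V x : ℂ) * ((starRingEnd ℂ) (φ x) * ψ x) :=
    (hVC.mul (hφs.continuous.mul hψ.continuous)).integrable_of_hasCompactSupport
      hψc.mul_left.mul_left
  rw [L2.inner_def, L2.inner_def]
  calc ∫ a, ⟪(minimalOperator V x : Space d → ℂ) a, (y : L2 d) a⟫_ℂ
      = ∫ a, (-(Δ (fun y => (starRingEnd ℂ) (φ y)) a * ψ a) +
          (V a : ℂ) * ((starRingEnd ℂ) (φ a) * ψ a)) := by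
        refine integral_congr_ae ?_
        filter_upwards [hx2, hy1] with a h1 h2
        rw [h1, h2, laplacian_star hφ, RCLike.inner_apply]
        simp only [map_add, map_neg, map_mul, Complex.conj_ofReal]
        ring
    _ = ∫ a, (-((starRingEnd ℂ) (φ a) * Δ ψ a) +
          (V a : ℂ) * ((starRingEnd ℂ) (φ a) * ψ a)) := by
        have hn1 : Integrable fun x => -(Δ (fun y => (starRingEnd ℂ) (φ y)) x * ψ x) := hi1.neg
        have hn2 : Integrable fun x => -((starRingEnd ℂ) (φ x) * Δ ψ x) := hi2.neg
        rw [integral_add hn1 hi3, integral_add hn2 hi3, integral_neg, integral_neg,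
          integral_mul_laplacian_comm hφs hφsc hψ hψc]
    _ = _ := by
        refine integral_congr_ae ?_
        filter_upwards [hx1, hy2] with a h1 h2
        rw [h1, h2, RCLike.inner_apply]
        ring

/-- The inner product is conjugate-linear in its first slot, so orthogonality of `u` is the weak
equation for `ū` with the same `z`. -/
theorem eq_zero_of_orthogonal_range {V : Space d → ℝ} (hV : Continuous V) {c : ℝ}
    (hc : ∀ x, |V x| ≤ c * (1 + ‖x‖)) {z : ℂ} (hz : z.im ≠ 0) (u : L2 d)
    (hu : ∀ x : (minimalOperator V).domain, ⟪u, minimalOperator V x - z • (x : L2 d)⟫_ℂ = 0) :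
    u = 0 := by
  have hw : MemLp (fun x => (starRingEnd ℂ) (u x)) 2 volume := by
    refine (memLp_congr_norm ?_ (Lp.aestronglyMeasurable u) (Eventually.of_forall fun x => ?_)).2
      (Lp.memLp u)
    · exact Complex.continuous_conj.comp_aestronglyMeasurable (Lp.aestronglyMeasurable u)
    · simp
  have hzero := weak_solution_eq_zero hV hc hz hw fun φ hφ hφc => by
    obtain ⟨x, hx1, hx2⟩ := exists_mem_domain hV hφ hφc
    have h := hu x
    rw [L2.inner_def] at h
    rw [← h]
    refine integral_congr_ae ?_
    filter_upwards [hx1, hx2, Lp.coeFn_sub (minimalOperator V x) (z • (x : L2 d)),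
      Lp.coeFn_smul z (x : L2 d)] with a h1 h2 h3 h4
    rw [h3, Pi.sub_apply, h4, Pi.smul_apply, h1, h2, RCLike.inner_apply, smul_eq_mul]
    ring
  refine Lp.ext ?_
  filter_upwards [hzero, Lp.coeFn_zero ℂ 2 (volume : Measure (Space d))] with x hx hx0
  rw [hx0]
  simpa using hx

theorem norm_sq_eq_integral (f : L2 d) : ‖f‖ ^ 2 = ∫ x, ‖f x‖ ^ 2 := by
  have h : ((‖f‖ ^ 2 : ℝ) : ℂ) = ((∫ x, ‖f x‖ ^ 2 : ℝ) : ℂ) := by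
    have h1 : ⟪f, f⟫_ℂ = ((‖f‖ : ℂ)) ^ 2 := inner_self_eq_norm_sq_to_K f
    push_cast
    rw [← h1, L2.inner_def, ← integral_complex_ofReal]
    refine integral_congr_ae (Eventually.of_forall fun x => ?_)
    simp
  exact_mod_cast h

theorem laplacian_ofReal {f : Space d → ℝ} (hf : ContDiff ℝ (⊤ : ℕ∞) f) (x : Space d) :
    Δ (fun y => (f y : ℂ)) x = ((Δ f x : ℝ) : ℂ) := by
  rw [laplacian_eq_sum_partialDeriv (contDiff_ofReal hf), laplacian_eq_sum_partialDeriv hf,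
    Complex.ofReal_sum]
  refine Finset.sum_congr rfl fun i _ => ?_
  rw [show partialDeriv i (fun y => (f y : ℂ)) = fun y => ((partialDeriv i f y : ℝ) : ℂ) from
    funext (partialDeriv_ofReal i hf), partialDeriv_ofReal i (contDiff_partialDeriv hf i)]

/-- If `V` is nearly equal to `l` on arbitrarily large balls, then `l` is an approximate eigenvalue
of `-Δ + V`. -/
theorem exists_approx_eigenvector {V : Space d → ℝ} (hV : Continuous V) {l : ℝ}
    (hflat : ∀ δ > 0, ∀ R > 0, ∃ x₀, ∀ y, ‖y - x₀‖ ≤ R → |V y - l| ≤ δ) {δ : ℝ} (hδ : 0 < δ) :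
    ∃ x : (minimalOperator V).domain, (x : L2 d) ≠ 0 ∧
      ‖minimalOperator V x - (l : ℂ) • (x : L2 d)‖ ≤ δ * ‖(x : L2 d)‖ := by
  obtain ⟨M, hM0, hcut⟩ := exists_cutoff d
  -- The residual is at most `2θ` on the ball of radius `2R`, whose volume is `2 ^ d` times that of
  -- the ball of radius `R` where the cutoff is one. Dividing by `2 ^ d`, more than the necessary
  -- square root, absorbs this ratio.
  set θ : ℝ := δ / (2 * 2 ^ d) with hθ_def
  have hθ : 0 < θ := by positivity
  obtain ⟨R, hR1, hRM⟩ : ∃ R : ℝ, 1 ≤ R ∧ M / R ^ 2 ≤ θ := by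
    refine ⟨1 + M / θ, by linarith [div_nonneg hM0 hθ.le], ?_⟩
    have h0 : 0 ≤ M / θ := div_nonneg hM0 hθ.le
    rw [div_le_iff₀ (by positivity)]
    have : M = θ * (M / θ) := by field_simp
    nlinarith [mul_nonneg hθ.le h0, mul_nonneg hθ.le (mul_nonneg h0 h0)]
  have hR : 0 < R := by linarith
  obtain ⟨χ, hχ, hχc, hχ0, hχ1, hχR, hχ2R, -, hχΔ⟩ := hcut R hR
  obtain ⟨x₀, hx₀⟩ := hflat θ hθ (2 * R) (by positivity)
  set ψ : Space d → ℝ := fun y => χ (x₀ - y) with hψ_def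
  have hψ : ContDiff ℝ (⊤ : ℕ∞) ψ := hχ.comp (contDiff_const.sub contDiff_id)
  have hψc : HasCompactSupport ψ := hχc.comp_homeomorph (Homeomorph.subLeft x₀)
  have hφc : HasCompactSupport fun y => (ψ y : ℂ) := hψc.comp_left Complex.ofReal_zero
  obtain ⟨x, hx1, hx2⟩ := exists_mem_domain hV (contDiff_ofReal hψ) hφc
  have hvol : (volume : Measure (Space d)).real (Metric.closedBall x₀ (2 * R)) =
      2 ^ d * (volume : Measure (Space d)).real (Metric.closedBall x₀ R) := by
    rw [Measure.real, Measure.real, Measure.addHaar_closedBall_mul _ _ (by norm_num) hR.le,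
      Measure.addHaar_closedBall_center volume x₀, finrank_euclideanSpace_fin, ENNReal.toReal_mul,
      ENNReal.toReal_ofReal (by positivity)]
  have hvolpos : 0 < (volume : Measure (Space d)).real (Metric.closedBall x₀ R) :=
    ENNReal.toReal_pos (Metric.measure_closedBall_pos _ _ hR).ne' measure_closedBall_lt_top.ne
  set m := (volume : Measure (Space d)).real (Metric.closedBall x₀ R) with hm
  have hlow : m ≤ ‖(x : L2 d)‖ ^ 2 := by
    rw [norm_sq_eq_integral, hm, ← integral_indicator_one measurableSet_closedBall]
    refine integral_mono_of_nonneg (Eventually.of_forall fun y => ?_) ?_ ?_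
    · exact Set.indicator_nonneg (fun _ _ => zero_le_one) y
    · exact (Lp.memLp (x : L2 d)).integrable_norm_pow (by simp)
    · filter_upwards [hx1] with y hy
      rw [hy]
      by_cases hyR : y ∈ Metric.closedBall x₀ R
      · have : χ (x₀ - y) = 1 := hχR _ (by
          rw [← dist_eq_norm, dist_comm]; exact hyR)
        simp [Set.indicator_of_mem hyR, hψ_def, this]
      · rw [Set.indicator_of_notMem hyR]; positivity
  have hup : ‖minimalOperator V x - (l : ℂ) • (x : L2 d)‖ ^ 2 ≤ (2 * θ) ^ 2 * (2 ^ d * m) := by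
    rw [norm_sq_eq_integral, ← hvol, mul_comm, ← smul_eq_mul, ← integral_indicator_const _
      measurableSet_closedBall]
    refine integral_mono_of_nonneg (Eventually.of_forall fun y => sq_nonneg _) ?_ ?_
    · exact (integrable_indicator_iff measurableSet_closedBall).2
        (integrableOn_const measure_closedBall_lt_top.ne)
    · filter_upwards [hx1, hx2, Lp.coeFn_sub (minimalOperator V x) ((l : ℂ) • (x : L2 d)),
        Lp.coeFn_smul (l : ℂ) (x : L2 d)] with y h1 h2 h3 h4
      rw [h3, Pi.sub_apply, h4, Pi.smul_apply, h1, h2, laplacian_ofReal hψ, smul_eq_mul]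
      have hval : -((Δ ψ y : ℝ) : ℂ) + (V y : ℂ) * (ψ y : ℂ) - (l : ℂ) * (ψ y : ℂ) =
          ((-(Δ ψ y) + (V y - l) * ψ y : ℝ) : ℂ) := by push_cast; ring
      rw [hval, Complex.norm_real, hψ_def, laplacian_comp_const_sub hχ]
      by_cases hy : y ∈ Metric.closedBall x₀ (2 * R)
      · rw [Set.indicator_of_mem hy]
        have hy' : ‖y - x₀‖ ≤ 2 * R := by rwa [← dist_eq_norm]
        have b1 : ‖-(Δ χ (x₀ - y)) + (V y - l) * χ (x₀ - y)‖ ≤ 2 * θ := by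
          calc _ ≤ ‖-(Δ χ (x₀ - y))‖ + ‖(V y - l) * χ (x₀ - y)‖ := norm_add_le _ _
            _ ≤ θ + θ * 1 := by
              rw [norm_neg, norm_mul, Real.norm_eq_abs, Real.norm_eq_abs, Real.norm_eq_abs,
                abs_of_nonneg (hχ0 _)]
              exact add_le_add ((hχΔ _).trans hRM)
                (mul_le_mul (hx₀ y hy') (hχ1 _) (hχ0 _) hθ.le)
            _ = _ := by ring
        gcongr
      · rw [Set.indicator_of_notMem hy]
        have hopen : ∀ᶠ y' in 𝓝 (x₀ - y), χ y' = 0 := by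
          have hy' : 2 * R < ‖x₀ - y‖ := by
            rw [Metric.mem_closedBall, not_le, dist_comm, dist_eq_norm] at hy
            exact hy
          filter_upwards [continuous_norm.continuousAt.eventually (lt_mem_nhds hy')] with y' hy''
          by_contra hne
          exact absurd (hχ2R y' hne) (not_lt.2 (le_of_lt hy''))
        have hΔ0 : Δ χ (x₀ - y) = 0 := by
          have h0 : χ =ᶠ[𝓝 (x₀ - y)] fun _ => (0 : ℝ) := hopen
          rw [(InnerProductSpace.laplacian_congr_nhds h0).eq_of_nhds]
          exact congrFun (InnerProductSpace.laplacian_const (E := Space d) (c := (0 : ℝ))) _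
        have hχ00 : χ (x₀ - y) = 0 := hopen.self_of_nhds
        simp [hΔ0, hχ00]
  refine ⟨x, fun h0 => ?_, ?_⟩
  · rw [h0] at hlow
    simp at hlow
    linarith
  · refine (pow_le_pow_iff_left₀ (norm_nonneg _) (by positivity) two_ne_zero).1 (hup.trans ?_)
    have h2d : (1 : ℝ) ≤ 2 ^ d := one_le_pow₀ one_le_two
    calc (2 * θ) ^ 2 * (2 ^ d * m) = δ ^ 2 * m / 2 ^ d := by
          rw [hθ_def]; field_simp
      _ ≤ δ ^ 2 * m := div_le_self (by positivity) h2d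
      _ ≤ δ ^ 2 * ‖(x : L2 d)‖ ^ 2 := by gcongr
      _ = _ := by ring

theorem isSelfAdjoint_schrodinger {V : Space d → ℝ} (hV : Continuous V) {c : ℝ}
    (hc : ∀ x, |V x| ≤ c * (1 + ‖x‖)) : IsSelfAdjoint (schrodinger V) :=
  isSelfAdjoint_closure (dense_domain_minimalOperator hV) (isFormalAdjoint_minimalOperator hV)
    fun _ hz u hu => eq_zero_of_orthogonal_range hV hc hz u hu

theorem spectrum_schrodinger {V : Space d → ℝ} (hV : Continuous V) {c : ℝ}
    (hc : ∀ x, |V x| ≤ c * (1 + ‖x‖))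
    (hflat : ∀ l : ℝ, ∀ δ > 0, ∀ R > 0, ∃ x₀, ∀ y, ‖y - x₀‖ ≤ R → |V y - l| ≤ δ) :
    spectrum (schrodinger V) = Set.range ((↑) : ℝ → ℂ) := by
  refine Set.Subset.antisymm (fun z hz => ?_) ?_
  · by_contra hcon
    have him : z.im ≠ 0 := fun h => hcon ⟨z.re, Complex.ext rfl (by simp [h])⟩
    exact hz (mem_resolventSet_closure (dense_domain_minimalOperator hV)
      (isFormalAdjoint_minimalOperator hV) him
      fun u hu => eq_zero_of_orthogonal_range hV hc him u hu)
  · rintro _ ⟨l, rfl⟩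
    refine mem_spectrum_of_approx fun δ hδ => ?_
    obtain ⟨x, hx0, hx⟩ := exists_approx_eigenvector hV (hflat l) hδ
    have hle := (minimalOperator V).le_closure
    refine ⟨⟨x, hle.1 x.2⟩, hx0, ?_⟩
    have : (schrodinger V) ⟨x, hle.1 x.2⟩ = minimalOperator V x := (hle.2 rfl).symm
    rw [this]
    exact hx

end Schrodinger

/-! ### Regularity of smoothed tempered distributions. -/

section Regularity

variable {d : ℕ}

theorem mollifierAt_apply {ϱ : Space d → ℝ} (hϱ : IsMollifier ϱ) {ε : ℝ} (hε : 0 < ε)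
    (x y : Space d) : mollifierAt hϱ hε x y = rescale ϱ ε (x - y) := rfl

theorem IsMollifier.contDiff_rescale_self {ϱ : Space d → ℝ} (hϱ : IsMollifier ϱ) (ε : ℝ) :
    ContDiff ℝ (⊤ : ℕ∞) (rescale ϱ ε) :=
  contDiff_const.mul (hϱ.contDiff.comp (contDiff_id.const_smul _))

theorem IsMollifier.rescale_neg {ϱ : Space d → ℝ} (hϱ : IsMollifier ϱ) (ε : ℝ) (y : Space d) :
    rescale ϱ ε (-y) = rescale ϱ ε y := by
  rw [rescale, rescale, smul_neg, hϱ.even]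

theorem IsMollifier.rescale_eq_zero {ϱ : Space d → ℝ} (hϱ : IsMollifier ϱ) {ε : ℝ} (hε : 0 < ε)
    {y : Space d} (hy : ε < ‖y‖) : rescale ϱ ε y = 0 := by
  have h0 : ϱ (ε⁻¹ • y) = 0 := by
    refine image_eq_zero_of_notMem_tsupport fun hmem => ?_
    have h1 := hϱ.tsupport_subset hmem
    rw [mem_closedBall_zero_iff, norm_smul, norm_inv, Real.norm_of_nonneg hε.le,
      inv_mul_le_iff₀ hε, mul_one] at h1
    exact absurd h1 (not_le.2 hy)
  simp [rescale, h0]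

theorem IsMollifier.tsupport_rescale_subset {ϱ : Space d → ℝ} (hϱ : IsMollifier ϱ) {ε : ℝ}
    (hε : 0 < ε) : tsupport (rescale ϱ ε) ⊆ Metric.closedBall 0 ε := by
  refine closure_minimal (fun y hy => ?_) Metric.isClosed_closedBall
  rw [mem_closedBall_zero_iff]
  by_contra hcon
  exact hy (hϱ.rescale_eq_zero hε (not_le.1 hcon))

theorem IsMollifier.hasCompactSupport_rescale_self {ϱ : Space d → ℝ} (hϱ : IsMollifier ϱ) {ε : ℝ}
    (hε : 0 < ε) : HasCompactSupport (rescale ϱ ε) :=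
  (isCompact_closedBall 0 ε).of_isClosed_subset (isClosed_tsupport _)
    (hϱ.tsupport_rescale_subset hε)

/-- The Schwartz seminorms of `ϱ_ε(x - ·) - ϱ_ε(y - ·)` grow polynomially in `x`, `y` and are
Lipschitz. -/
theorem seminorm_mollifierAt_sub_le {ϱ : Space d → ℝ} (hϱ : IsMollifier ϱ) {ε : ℝ} (hε : 0 < ε)
    (k n : ℕ) : ∃ L : ℝ, 0 ≤ L ∧ ∀ x y,
      SchwartzMap.seminorm ℝ k n (mollifierAt hϱ hε x - mollifierAt hϱ hε y) ≤
        L * (ε + ‖x‖ + ‖y‖) ^ k * ‖x - y‖ := by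
  set ψ := rescale ϱ ε with hψ_def
  have hψ : ContDiff ℝ (⊤ : ℕ∞) ψ := hϱ.contDiff_rescale_self ε
  have hψc : HasCompactSupport ψ := hϱ.hasCompactSupport_rescale_self hε
  obtain ⟨L, hL⟩ := ContDiff.lipschitzWith_of_hasCompactSupport (𝕂 := ℝ) (n := 1)
    (f := iteratedFDeriv ℝ n ψ) (hψc.iteratedFDeriv n)
    (hψ.iteratedFDeriv_right (by exact_mod_cast le_top)) one_ne_zero
  refine ⟨L, L.2, fun x y => SchwartzMap.seminorm_le_bound ℝ k n _ (by positivity) fun u => ?_⟩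
  -- Evenness of the mollifier turns the reflection into a pure translation.
  have hx : ∀ x : Space d, (mollifierAt hϱ hε x : Space d → ℝ) = fun u => ψ (u - x) := fun x => by
    ext u
    rw [mollifierAt_apply, ← neg_sub, hϱ.rescale_neg]
  have hsm : ∀ x : Space d, ContDiff ℝ n fun u => ψ (u - x) := fun x =>
    (hψ.comp (contDiff_id.sub contDiff_const)).of_le (by exact_mod_cast le_top)
  have hD : iteratedFDeriv ℝ n (mollifierAt hϱ hε x - mollifierAt hϱ hε y : 𝓢(Space d, ℝ)) u =
      iteratedFDeriv ℝ n ψ (u - x) - iteratedFDeriv ℝ n ψ (u - y) := by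
    have : ((mollifierAt hϱ hε x - mollifierAt hϱ hε y : 𝓢(Space d, ℝ)) : Space d → ℝ) =
        (fun u => ψ (u - x)) - fun u => ψ (u - y) := by
      rw [← hx, ← hx]; rfl
    rw [this, iteratedFDeriv_sub_apply (hsm x).contDiffAt (hsm y).contDiffAt,
      iteratedFDeriv_comp_sub, iteratedFDeriv_comp_sub]
  rw [hD]
  have hlip : ‖iteratedFDeriv ℝ n ψ (u - x) - iteratedFDeriv ℝ n ψ (u - y)‖ ≤ L * ‖x - y‖ := by
    have := hL.dist_le_mul (u - x) (u - y)
    rw [dist_eq_norm, dist_eq_norm] at this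
    rwa [show u - x - (u - y) = y - x by abel, norm_sub_rev y x] at this
  have hzero : ∀ v : Space d, ε < ‖v‖ → iteratedFDeriv ℝ n ψ v = 0 := fun v hv =>
    image_eq_zero_of_notMem_tsupport fun hmem => by
      have := hϱ.tsupport_rescale_subset hε (tsupport_iteratedFDeriv_subset n hmem)
      rw [mem_closedBall_zero_iff] at this
      exact absurd this (not_le.2 hv)
  -- Beyond this radius both translates vanish, so the weight `‖u‖ ^ k` costs only polynomial
  -- growth.
  by_cases hu : ‖u‖ ≤ ε + ‖x‖ + ‖y‖
  · calc ‖u‖ ^ k * ‖iteratedFDeriv ℝ n ψ (u - x) - iteratedFDeriv ℝ n ψ (u - y)‖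
        ≤ (ε + ‖x‖ + ‖y‖) ^ k * (L * ‖x - y‖) := by gcongr
      _ = _ := by ring
  · rw [not_le] at hu
    have h1 := norm_sub_norm_le u x
    have h2 := norm_sub_norm_le u y
    rw [hzero (u - x) (by linarith [norm_nonneg y]), hzero (u - y) (by linarith [norm_nonneg x])]
    simp only [sub_self, norm_zero, mul_zero]
    positivity

/-- The regularisation of a tempered distribution is locally Lipschitz, with constants of polynomial
growth. -/
theorem exists_smoothed_lipschitz {ϱ : Space d → ℝ} (hϱ : IsMollifier ϱ) {ε : ℝ} (hε : 0 < ε)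
    (hε1 : ε < 1) (ξ : 𝓢(Space d, ℝ) →L[ℝ] ℝ) : ∃ K : ℝ, 0 ≤ K ∧ ∃ N : ℕ, ∀ x y,
      |smoothed hϱ hε ξ x - smoothed hϱ hε ξ y| ≤ K * (1 + ‖x‖ + ‖y‖) ^ N * ‖x - y‖ := by
  -- A continuous functional is bounded by finitely many Schwartz seminorms; the largest weight
  -- among them gives the growth exponent `N`, which depends on `ξ`.
  obtain ⟨s, C, -, hC⟩ := Seminorm.bound_of_continuous
    (schwartz_withSeminorms ℝ (Space d) ℝ) ((normSeminorm ℝ ℝ).comp ξ.toLinearMap)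
    (by exact continuous_norm.comp ξ.continuous)
  choose L hL0 hL using fun q : ℕ × ℕ => seminorm_mollifierAt_sub_le hϱ hε q.1 q.2
  set N := s.sup Prod.fst with hN
  refine ⟨C * ∑ q ∈ s, L q, mul_nonneg C.2 (Finset.sum_nonneg fun q _ => hL0 q), N, fun x y => ?_⟩
  set φ := mollifierAt hϱ hε x - mollifierAt hϱ hε y with hφ
  have h1 : |smoothed hϱ hε ξ x - smoothed hϱ hε ξ y| = ‖ξ φ‖ := by
    rw [hφ, map_sub, Real.norm_eq_abs]; rfl
  have h2 : ‖ξ φ‖ ≤ C * ∑ q ∈ s, SchwartzMap.seminorm ℝ q.1 q.2 φ := by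
    have h3 := hC φ
    have h4 : (s.sup (schwartzSeminormFamily ℝ (Space d) ℝ)) φ ≤
        ∑ q ∈ s, SchwartzMap.seminorm ℝ q.1 q.2 φ :=
      Seminorm.finset_sup_apply_le (Finset.sum_nonneg fun q _ => apply_nonneg _ _) fun q hq =>
        Finset.single_le_sum (f := fun q : ℕ × ℕ => SchwartzMap.seminorm ℝ q.1 q.2 φ)
          (fun q _ => apply_nonneg _ _) hq
    refine h3.trans ?_
    change (C : ℝ) * (s.sup (schwartzSeminormFamily ℝ (Space d) ℝ)) φ ≤ _
    exact mul_le_mul_of_nonneg_left h4 C.2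
  rw [h1]
  refine h2.trans ?_
  rw [mul_assoc, mul_assoc, Finset.sum_mul]
  refine mul_le_mul_of_nonneg_left (Finset.sum_le_sum fun q hq => ?_) C.2
  refine (hL q x y).trans ?_
  rw [mul_assoc]
  refine mul_le_mul_of_nonneg_left ?_ (hL0 q)
  refine mul_le_mul_of_nonneg_right ?_ (norm_nonneg _)
  have hbase : (1 : ℝ) ≤ 1 + ‖x‖ + ‖y‖ := by linarith [norm_nonneg x, norm_nonneg y]
  calc (ε + ‖x‖ + ‖y‖) ^ q.1 ≤ (1 + ‖x‖ + ‖y‖) ^ q.1 := by gcongr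
    _ ≤ (1 + ‖x‖ + ‖y‖) ^ N := pow_le_pow_right₀ hbase (Finset.le_sup (f := Prod.fst) hq)

theorem continuous_smoothed {ϱ : Space d → ℝ} (hϱ : IsMollifier ϱ) {ε : ℝ} (hε : 0 < ε)
    (hε1 : ε < 1) (ξ : 𝓢(Space d, ℝ) →L[ℝ] ℝ) : Continuous (smoothed hϱ hε ξ) := by
  obtain ⟨K, -, N, h⟩ := exists_smoothed_lipschitz hϱ hε hε1 ξ
  refine continuous_iff_continuousAt.2 fun x => ?_
  rw [ContinuousAt, tendsto_iff_dist_tendsto_zero]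
  have hlim : Filter.Tendsto (fun y => K * (1 + ‖y‖ + ‖x‖) ^ N * ‖y - x‖) (nhds x) (nhds 0) := by
    have hc : Continuous fun y : Space d => K * (1 + ‖y‖ + ‖x‖) ^ N * ‖y - x‖ := by fun_prop
    simpa using hc.tendsto x
  exact squeeze_zero (fun _ => dist_nonneg) (fun y => h y x) hlim

end Regularity

/-! ### Almost sure linear growth of the smoothed noise. -/

section Growth

variable {d : ℕ} {Ω : Type*} [MeasurableSpace Ω] {P : Measure Ω}
  {ξ : Ω → (𝓢(Space d, ℝ) →L[ℝ] ℝ)}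

/-- The one-point distribution of the regularised noise does not depend on the point. -/
theorem IsWhiteNoise.hasLaw_smoothed (hξ : IsWhiteNoise P ξ) {ϱ : Space d → ℝ}
    (hϱ : IsMollifier ϱ) {ε : ℝ} (hε : 0 < ε) (x : Space d) :
    HasLaw (fun ω => smoothed hϱ hε (ξ ω) x)
      (gaussianReal 0 (∫ y, rescale ϱ ε y ^ 2).toNNReal) P := by
  have h := hξ (mollifierAt hϱ hε x)
  simp_rw [mollifierAt_apply] at h
  rwa [integral_sub_left_eq_self (fun y => rescale ϱ ε y ^ 2) volume x] at h

variable [IsProbabilityMeasure P]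

/-- Markov's inequality for the `p`-th moment. By stationarity `A` does not depend on `x`, and `p`
is free so that the decay can beat the number of grid points. -/
theorem IsWhiteNoise.exists_tail_bound (hξ : IsWhiteNoise P ξ) {ϱ : Space d → ℝ}
    (hϱ : IsMollifier ϱ) {ε : ℝ} (hε : 0 < ε) (p : ℕ) : ∃ A : ℝ, 0 ≤ A ∧ ∀ x, ∀ m : ℝ, 0 < m →
      P.real {ω | m ≤ |smoothed hϱ hε (ξ ω) x|} ≤ A / m ^ p := by
  set γ := gaussianReal 0 (∫ y, rescale ϱ ε y ^ 2).toNNReal with hγ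
  have hint : Integrable (fun t : ℝ => |t| ^ p) γ := by
    rcases eq_or_ne p 0 with rfl | hp
    · simp
    have := (memLp_id_gaussianReal (μ := 0) (v := (∫ y, rescale ϱ ε y ^ 2).toNNReal)
      (p : NNReal)).integrable_norm_rpow (by simpa using hp) (by simp)
    simpa using this
  refine ⟨∫ t, |t| ^ p ∂γ, integral_nonneg fun t => by positivity, fun x m hm => ?_⟩
  have hlaw := hξ.hasLaw_smoothed hϱ hε x
  have hset : P.real {ω | m ≤ |smoothed hϱ hε (ξ ω) x|} ≤ γ.real {t | m ^ p ≤ |t| ^ p} := by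
    rw [← hγ] at hlaw
    have hmeas : MeasurableSet {t : ℝ | m ^ p ≤ |t| ^ p} :=
      measurableSet_le measurable_const (by fun_prop)
    rw [← hlaw.map_eq, map_measureReal_apply_of_aemeasurable hlaw.aemeasurable hmeas]
    refine measureReal_mono fun ω hω => ?_
    have hω' : m ≤ |smoothed hϱ hε (ξ ω) x| := hω
    exact pow_le_pow_left₀ hm.le hω' p
  refine hset.trans ?_
  rw [le_div_iff₀ (by positivity), mul_comm]
  exact mul_meas_ge_le_integral_of_nonneg (Filter.Eventually.of_forall fun t => by positivity)
    hint _

/-- The point of the grid of mesh `m⁻ᴺ` with integer coordinates `k`. -/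
def gridPoint (N m : ℕ) (k : Fin d → ℤ) : Space d :=
  WithLp.toLp 2 fun i => (k i : ℝ) / (m : ℝ) ^ N

/-- The coordinates of the grid points in the cube of side `2 m`. -/
def gridIndex (d N m : ℕ) : Finset (Fin d → ℤ) :=
  Fintype.piFinset fun _ => Finset.Icc (-((m : ℤ) ^ (N + 1))) ((m : ℤ) ^ (N + 1))

theorem card_gridIndex_le (d N m : ℕ) (hm : 1 ≤ m) :
    ((gridIndex d N m).card : ℝ) ≤ 3 ^ d * (m : ℝ) ^ ((N + 1) * d) := by
  have h1 : (gridIndex d N m).card = (2 * m ^ (N + 1) + 1) ^ d := by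
    rw [gridIndex, Fintype.card_piFinset_const, Int.card_Icc]
    congr 1
    have : (m : ℤ) ^ (N + 1) + 1 - -((m : ℤ) ^ (N + 1)) = ((2 * m ^ (N + 1) + 1 : ℕ) : ℤ) := by
      push_cast; ring
    rw [this, Int.toNat_natCast]
  have h2 : (1 : ℝ) ≤ (m : ℝ) ^ (N + 1) := one_le_pow₀ (by exact_mod_cast hm)
  rw [h1]
  push_cast
  calc (2 * (m : ℝ) ^ (N + 1) + 1) ^ d ≤ (3 * (m : ℝ) ^ (N + 1)) ^ d := by
        gcongr; linarith
    _ = _ := by rw [mul_pow, ← pow_mul]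

/-- Coordinates are rounded down; the factor `d` is a crude bound for `√d`. -/
theorem exists_gridPoint_near (N : ℕ) {m : ℕ} (hm : 1 ≤ m) {x : Space d} (hx : ‖x‖ ≤ m) :
    ∃ k ∈ gridIndex d N m, ‖x - gridPoint N m k‖ ≤ d / (m : ℝ) ^ N := by
  have hm0 : (0 : ℝ) < (m : ℝ) ^ N := pow_pos (by exact_mod_cast hm) N
  refine ⟨fun i => ⌊x i * (m : ℝ) ^ N⌋, ?_, ?_⟩
  · refine Fintype.mem_piFinset.2 fun i => Finset.mem_Icc.2 ?_
    have hi : |x i| ≤ m := by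
      have := PiLp.norm_apply_le x i
      rw [Real.norm_eq_abs] at this
      exact this.trans hx
    have hi' := abs_le.1 hi
    constructor
    · rw [Int.le_floor]
      push_cast
      rw [pow_succ]
      nlinarith
    · rw [← Int.cast_le (R := ℝ)]
      refine (Int.floor_le _).trans ?_
      push_cast
      rw [pow_succ]
      nlinarith
  · have hcoord : ∀ i, ‖(x - gridPoint N m fun i => ⌊x i * (m : ℝ) ^ N⌋) i‖ ^ 2 ≤
        (1 / (m : ℝ) ^ N) ^ 2 := by
      intro i
      have h1 : (x - gridPoint N m fun i => ⌊x i * (m : ℝ) ^ N⌋) i =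
          (x i * (m : ℝ) ^ N - ⌊x i * (m : ℝ) ^ N⌋) / (m : ℝ) ^ N := by
        simp only [gridPoint, PiLp.sub_apply]
        field_simp
      rw [h1, norm_div, Real.norm_of_nonneg hm0.le, Real.norm_eq_abs, Int.self_sub_floor,
        abs_of_nonneg (Int.fract_nonneg _)]
      have := Int.fract_lt_one (x i * (m : ℝ) ^ N)
      have := Int.fract_nonneg (x i * (m : ℝ) ^ N)
      gcongr
    refine (pow_le_pow_iff_left₀ (norm_nonneg _) (by positivity) two_ne_zero).1 ?_
    rw [EuclideanSpace.norm_sq_eq]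
    calc _ ≤ ∑ _i : Fin d, (1 / (m : ℝ) ^ N) ^ 2 := Finset.sum_le_sum fun i _ => hcoord i
      _ = d * (1 / (m : ℝ) ^ N) ^ 2 := by simp
      _ ≤ (d : ℝ) ^ 2 * (1 / (m : ℝ) ^ N) ^ 2 := by
          gcongr
          exact_mod_cast Nat.le_self_pow two_ne_zero d
      _ = _ := by ring

/-- Almost surely, the regularised noise is at most `m` on the `m`-th grid, for large `m`. -/
theorem IsWhiteNoise.ae_eventually_grid_lt (hξ : IsWhiteNoise P ξ) {ϱ : Space d → ℝ}
    (hϱ : IsMollifier ϱ) {ε : ℝ} (hε : 0 < ε) (N : ℕ) :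
    ∀ᵐ ω ∂P, ∀ᶠ m : ℕ in Filter.atTop, ∀ k ∈ gridIndex d N m,
      |smoothed hϱ hε (ξ ω) (gridPoint N m k)| < m := by
  -- The `m`-th grid has `O(m ^ ((N + 1) * d))` points, so two further powers leave the summable
  -- bound `m⁻²` for Borel–Cantelli.
  obtain ⟨A, hA0, hA⟩ := hξ.exists_tail_bound hϱ hε ((N + 1) * d + 2)
  set E : ℕ → Set Ω := fun m => ⋃ k ∈ gridIndex d N m,
    {ω | (m : ℝ) ≤ |smoothed hϱ hε (ξ ω) (gridPoint N m k)|} with hE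
  have hbound : ∀ m : ℕ, P.real (E (m + 1)) ≤ 3 ^ d * A * (1 / ((m + 1 : ℕ) : ℝ) ^ 2) := by
    intro m
    have hm0 : (0 : ℝ) < ((m + 1 : ℕ) : ℝ) := by positivity
    calc P.real (E (m + 1)) ≤ ∑ k ∈ gridIndex d N (m + 1), P.real
          {ω | ((m + 1 : ℕ) : ℝ) ≤ |smoothed hϱ hε (ξ ω) (gridPoint N (m + 1) k)|} :=
          measureReal_biUnion_finset_le _ _
      _ ≤ ∑ _k ∈ gridIndex d N (m + 1), A / ((m + 1 : ℕ) : ℝ) ^ ((N + 1) * d + 2) :=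
          Finset.sum_le_sum fun k _ => hA _ _ hm0
      _ = (gridIndex d N (m + 1)).card * (A / ((m + 1 : ℕ) : ℝ) ^ ((N + 1) * d + 2)) := by
          rw [Finset.sum_const, nsmul_eq_mul]
      _ ≤ (3 ^ d * ((m + 1 : ℕ) : ℝ) ^ ((N + 1) * d)) *
          (A / ((m + 1 : ℕ) : ℝ) ^ ((N + 1) * d + 2)) := by
          have := card_gridIndex_le d N (m + 1) (by omega)
          gcongr
      _ = _ := by
          rw [pow_add]
          field_simp
  have hsum : Summable fun m : ℕ => P.real (E (m + 1)) := by
    refine Summable.of_nonneg_of_le (fun m => measureReal_nonneg) hbound (Summable.mul_left _ ?_)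
    exact (summable_nat_add_iff 1).2 (Real.summable_one_div_nat_pow.2 one_lt_two)
  have hfin : ∑' m : ℕ, P (E (m + 1)) ≠ ⊤ := by
    have := hsum.tsum_ofReal_ne_top
    simpa [ofReal_measureReal] using this
  filter_upwards [ae_eventually_notMem hfin] with ω hω
  obtain ⟨m₀, hm₀⟩ := Filter.eventually_atTop.1 hω
  refine Filter.eventually_atTop.2 ⟨m₀ + 1, fun m hm k hk => ?_⟩
  obtain ⟨m, rfl⟩ : ∃ n, m = n + 1 := ⟨m - 1, by omega⟩
  by_contra hcon
  exact hm₀ m (by omega) (Set.mem_biUnion hk (not_lt.1 hcon))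

/-- Almost surely, the regularised noise grows at most linearly. -/
theorem IsWhiteNoise.ae_linear_growth (hξ : IsWhiteNoise P ξ) {ϱ : Space d → ℝ}
    (hϱ : IsMollifier ϱ) {ε : ℝ} (hε : 0 < ε) (hε1 : ε < 1) :
    ∀ᵐ ω ∂P, ∃ c : ℝ, ∀ x, |smoothed hϱ hε (ξ ω) x| ≤ c * (1 + ‖x‖) := by
  -- The exponent `N` depends on the sample, so the grid bound must hold for all `N` at once before
  -- it is chosen.
  filter_upwards [ae_all_iff.2 fun N => hξ.ae_eventually_grid_lt hϱ hε N] with ω hω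
  obtain ⟨K, hK0, N, hKN⟩ := exists_smoothed_lipschitz hϱ hε hε1 (ξ ω)
  obtain ⟨m₀, hm₀⟩ := Filter.eventually_atTop.1 (hω N)
  -- The mesh `m ^ (-N)` cancels the growth `m ^ N` of the Lipschitz constant, so the error between
  -- grid points is bounded independently of `m`.
  set D := K * (3 + d : ℝ) ^ N * d with hD
  have hD0 : 0 ≤ D := by positivity
  refine ⟨m₀ + 2 + D, fun x => ?_⟩
  -- Large enough for the grid bound and for the cube to contain `x`, yet at most `‖x‖ + m₀ + 2`,
  -- which yields linear growth.
  set m : ℕ := m₀ + ⌈‖x‖⌉₊ + 1 with hm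
  have hm1 : 1 ≤ m := by omega
  have hmx : ‖x‖ ≤ m := by
    have := Nat.le_ceil ‖x‖
    rw [hm]; push_cast
    linarith [(Nat.cast_nonneg m₀ : (0 : ℝ) ≤ m₀)]
  have hmle : (m : ℝ) ≤ m₀ + ‖x‖ + 2 := by
    have := Nat.ceil_lt_add_one (norm_nonneg x)
    rw [hm]; push_cast
    linarith
  have hm1' : (1 : ℝ) ≤ m := by exact_mod_cast hm1
  have hmN : (1 : ℝ) ≤ (m : ℝ) ^ N := one_le_pow₀ hm1'
  obtain ⟨k, hk, hkx⟩ := exists_gridPoint_near N hm1 hmx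
  have h1 := hm₀ m (by omega) k hk
  have hp : ‖gridPoint N m k‖ ≤ m + d := by
    have h2 : ‖gridPoint N m k‖ ≤ ‖x‖ + ‖x - gridPoint N m k‖ := by
      have := norm_sub_norm_le (gridPoint N m k) x
      rw [norm_sub_rev] at this
      linarith
    have h3 : (d : ℝ) / (m : ℝ) ^ N ≤ d := div_le_self (Nat.cast_nonneg d) hmN
    linarith
  have hlip : |smoothed hϱ hε (ξ ω) x - smoothed hϱ hε (ξ ω) (gridPoint N m k)| ≤ D := by
    refine (hKN x (gridPoint N m k)).trans ?_
    have hb : 1 + ‖x‖ + ‖gridPoint N m k‖ ≤ (3 + d) * m := by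
      nlinarith [(Nat.cast_nonneg d : (0 : ℝ) ≤ d)]
    calc K * (1 + ‖x‖ + ‖gridPoint N m k‖) ^ N * ‖x - gridPoint N m k‖
        ≤ K * ((3 + d) * m) ^ N * (d / (m : ℝ) ^ N) := by gcongr
      _ = D := by
          rw [mul_pow, hD]
          field_simp
  have habs := abs_sub_abs_le_abs_sub (smoothed hϱ hε (ξ ω) x)
    (smoothed hϱ hε (ξ ω) (gridPoint N m k))
  have hx0 := norm_nonneg x
  nlinarith [(Nat.cast_nonneg m₀ : (0 : ℝ) ≤ m₀), mul_nonneg hD0 hx0,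
    mul_nonneg (Nat.cast_nonneg m₀ : (0 : ℝ) ≤ m₀) hx0]

end Growth

/-! ### Gaussian structure and small ball probabilities. -/

section GaussianField

open Filter Topology

variable {d : ℕ} {Ω : Type*} [MeasurableSpace Ω] {P : Measure Ω}
  {ξ : Ω → (𝓢(Space d, ℝ) →L[ℝ] ℝ)}

theorem IsWhiteNoise.aemeasurable (hξ : IsWhiteNoise P ξ) (φ : 𝓢(Space d, ℝ)) :
    AEMeasurable (fun ω => ξ ω φ) P :=
  (hξ φ).aemeasurable

theorem IsWhiteNoise.aemeasurable_pi (hξ : IsWhiteNoise P ξ) {ι : Type*} [Countable ι]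
    (φ : ι → 𝓢(Space d, ℝ)) : AEMeasurable (fun ω i => ξ ω (φ i)) P :=
  aemeasurable_pi_iff.2 fun i => hξ.aemeasurable (φ i)

/-- Linear images of finitely many evaluations of a white noise are Gaussian. -/
theorem IsWhiteNoise.map_strongDual (hξ : IsWhiteNoise P ξ) {ι : Type*} [Fintype ι]
    [DecidableEq ι] (φ : ι → 𝓢(Space d, ℝ)) (L : StrongDual ℝ (ι → ℝ)) :
    (P.map fun ω i => ξ ω (φ i)).map L = gaussianReal 0
      (∫ y, (∑ i, L (Pi.single i 1) • φ i : 𝓢(Space d, ℝ)) y ^ 2).toNNReal := by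
  have hL : (L ∘ fun ω i => ξ ω (φ i)) = fun ω => ξ ω (∑ i, L (Pi.single i 1) • φ i) := by
    ext ω
    have h := LinearMap.pi_apply_eq_sum_univ (L : (ι → ℝ) →ₗ[ℝ] ℝ) (fun i => ξ ω (φ i))
    have hs : ∀ i : ι, (fun j => if i = j then (1 : ℝ) else 0) = Pi.single i 1 := fun i => by
      ext j
      simp [Pi.single_apply, eq_comm]
    simp only [Function.comp_apply, map_sum, map_smul, smul_eq_mul]
    simp only [hs, ContinuousLinearMap.coe_coe, smul_eq_mul] at h
    rw [h]
    exact Finset.sum_congr rfl fun i _ => mul_comm _ _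
  rw [AEMeasurable.map_map_of_aemeasurable L.continuous.measurable.aemeasurable
    (hξ.aemeasurable_pi φ), hL]
  exact (hξ _).map_eq

theorem IsWhiteNoise.isGaussian_map (hξ : IsWhiteNoise P ξ) {ι : Type*} [Fintype ι]
    (φ : ι → 𝓢(Space d, ℝ)) : IsGaussian (P.map fun ω i => ξ ω (φ i)) := by
  classical
  exact isGaussian_of_map_eq_gaussianReal fun L => ⟨0, _, hξ.map_strongDual φ L⟩

theorem IsWhiteNoise.isGaussianProcess (hξ : IsWhiteNoise P ξ) :
    IsGaussianProcess (fun φ ω => ξ ω φ) P :=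
  ⟨fun I => ⟨hξ.isGaussian_map fun i : I => (i : 𝓢(Space d, ℝ))⟩⟩

/-- The law of finitely many evaluations is determined by the `L²` norms of their linear
combinations. -/
theorem IsWhiteNoise.map_eq_map [IsProbabilityMeasure P] (hξ : IsWhiteNoise P ξ) {ι : Type*}
    [Fintype ι] {φ φ' : ι → 𝓢(Space d, ℝ)}
    (h : ∀ c : ι → ℝ, ∫ y, (∑ i, c i • φ i : 𝓢(Space d, ℝ)) y ^ 2 =
      ∫ y, (∑ i, c i • φ' i : 𝓢(Space d, ℝ)) y ^ 2) :
    (P.map fun ω i => ξ ω (φ i)) = P.map fun ω i => ξ ω (φ' i) := by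
  classical
  have := Measure.isProbabilityMeasure_map (hξ.aemeasurable_pi φ)
  have := Measure.isProbabilityMeasure_map (hξ.aemeasurable_pi φ')
  refine Measure.ext_of_charFunDual (funext fun L => ?_)
  rw [charFunDual_eq_charFun_map_one, charFunDual_eq_charFun_map_one, hξ.map_strongDual,
    hξ.map_strongDual, h]

theorem integrable_mul_schwartz (φ ψ : 𝓢(Space d, ℝ)) : Integrable fun y => φ y * ψ y :=
  (φ.memLp 2 volume).integrable_mul (ψ.memLp 2 volume)

/-- The covariance of a white noise is the `L²` inner product. -/
theorem IsWhiteNoise.covariance_eq [IsProbabilityMeasure P] (hξ : IsWhiteNoise P ξ)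
    (φ ψ : 𝓢(Space d, ℝ)) : cov[fun ω => ξ ω φ, fun ω => ξ ω ψ; P] = ∫ y, φ y * ψ y := by
  have hvar : ∀ χ : 𝓢(Space d, ℝ), Var[fun ω => ξ ω χ; P] = ∫ y, χ y ^ 2 := fun χ => by
    rw [(hξ χ).variance_eq, variance_id_gaussianReal,
      Real.coe_toNNReal _ (integral_nonneg fun y => sq_nonneg _)]
  have hmem : ∀ χ : 𝓢(Space d, ℝ), MemLp (fun ω => ξ ω χ) 2 P := fun χ =>
    (hξ.isGaussianProcess.hasGaussianLaw_eval χ).memLp_two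
  -- Polarisation: the variance of `⟨ξ, φ + ψ⟩` determines the covariance.
  have h1 := variance_add (hmem φ) (hmem ψ)
  have h2 : ((fun ω => ξ ω φ) + fun ω => ξ ω ψ) = fun ω => ξ ω (φ + ψ) := by
    ext ω; simp
  rw [h2, hvar, hvar, hvar] at h1
  have h3 : ∫ y, (φ + ψ) y ^ 2 = (∫ y, φ y ^ 2) + 2 * (∫ y, φ y * ψ y) + ∫ y, ψ y ^ 2 := by
    have hi1 : Integrable fun y => φ y ^ 2 := by
      simpa [sq] using integrable_mul_schwartz φ φ
    have hi2 : Integrable fun y => ψ y ^ 2 := by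
      simpa [sq] using integrable_mul_schwartz ψ ψ
    have hi3 : Integrable fun y => 2 * (φ y * ψ y) := (integrable_mul_schwartz φ ψ).const_mul 2
    have hi4 : Integrable fun y => φ y ^ 2 + 2 * (φ y * ψ y) := hi1.add hi3
    rw [← integral_const_mul, ← integral_add hi1 hi3, ← integral_add hi4 hi2]
    refine integral_congr_ae (Eventually.of_forall fun y => ?_)
    simp only [add_apply]
    ring
  linarith

/-- Symmetrisation: a centred Gaussian measure charges the cube of side `4 δ` centred at the origin
as soon as it charges some cube of side `2 δ`. -/
theorem sq_measure_cube_le {ι : Type*} [Fintype ι] {μ : Measure (ι → ℝ)} [IsGaussian μ]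
    (hμ : ∀ L : StrongDual ℝ (ι → ℝ), ∫ x, L x ∂μ = 0) (f : ι → ℝ) (δ : ℝ) :
    μ {x | ∀ i, |x i - f i| ≤ δ} ^ 2 ≤ μ {x | ∀ i, |x i| ≤ 2 * δ} := by
  have hmeas : ∀ (g : ι → ℝ) (r : ℝ), MeasurableSet {x : ι → ℝ | ∀ i, |x i - g i| ≤ r} :=
    fun g r => by
      simp only [Set.ofPred_forall]
      exact MeasurableSet.iInter fun i =>
        measurableSet_le (((measurable_pi_apply i).sub_const _).abs) measurable_const
  have hS : MeasurableSet {x : ι → ℝ | ∀ i, |x i| ≤ 2 * δ} := by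
    simpa using hmeas 0 (2 * δ)
  set B := {x : ι → ℝ | ∀ i, |x i - f i| ≤ δ} with hB
  set S := {x : ι → ℝ | ∀ i, |x i| ≤ 2 * δ} with hS_def
  -- For independent copies `X`, `Y`, the rotation preserves the joint law and has first component
  -- `(X - Y) / √2`. If both copies lie within `δ` of `f`, the centre cancels in `X - Y`.
  have hrot := IsGaussian.map_rotation_eq_self_of_forall_strongDual_eq_zero hμ (-(Real.pi / 4))
  calc μ B ^ 2 = (μ.prod μ) (B ×ˢ B) := by rw [Measure.prod_prod, sq]
    _ ≤ (μ.prod μ) (ContinuousLinearMap.rotation (-(Real.pi / 4)) ⁻¹' (S ×ˢ Set.univ)) := by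
        refine measure_mono fun p hp => ⟨fun i => ?_, trivial⟩
        have h1 : |p.1 i - f i| ≤ δ := hp.1 i
        have h2 : |p.2 i - f i| ≤ δ := hp.2 i
        have h3 : |p.1 i - p.2 i| ≤ 2 * δ := by
          have := abs_sub (p.1 i - f i) (p.2 i - f i)
          rw [sub_sub_sub_cancel_right] at this
          linarith
        rw [ContinuousLinearMap.rotation_apply]
        have h4 : (Real.cos (-(Real.pi / 4)) • p.1 + Real.sin (-(Real.pi / 4)) • p.2) i =
            Real.cos (Real.pi / 4) * (p.1 i - p.2 i) := by
          simp only [Real.cos_neg, Real.sin_neg, Pi.add_apply, Pi.smul_apply, smul_eq_mul,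
            Real.cos_pi_div_four, Real.sin_pi_div_four]
          ring
        change |(Real.cos (-(Real.pi / 4)) • p.1 + Real.sin (-(Real.pi / 4)) • p.2) i| ≤ _
        rw [h4, abs_mul]
        calc |Real.cos (Real.pi / 4)| * |p.1 i - p.2 i| ≤ 1 * |p.1 i - p.2 i| := by
              gcongr
              exact Real.abs_cos_le_one _
          _ ≤ _ := by rw [one_mul]; exact h3
    _ = (μ.prod μ) (S ×ˢ Set.univ) := by
        nth_rw 2 [← hrot]
        rw [Measure.map_apply (by fun_prop) (hS.prod MeasurableSet.univ)]
    _ = μ S := by rw [Measure.prod_prod, measure_univ, mul_one]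

/-- Small ball probabilities: if the sample paths `(⟨ξ, φ i⟩)ᵢ` can be covered by countably many
uniform balls of radius `δ`, then they are uniformly small with positive probability. -/
theorem IsWhiteNoise.measure_small_pos [IsProbabilityMeasure P] (hξ : IsWhiteNoise P ξ)
    (φ : ℕ → 𝓢(Space d, ℝ)) {δ : ℝ} (F : ℕ → ℕ → ℝ)
    (hF : ∀ ω, ∃ n, ∀ i, |ξ ω (φ i) - F n i| ≤ δ) :
    0 < P {ω | ∀ i, |ξ ω (φ i)| ≤ 2 * δ} := by
  -- Countably many events cover the whole space, so one of them is not null.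
  obtain ⟨n, hn⟩ : ∃ n, 0 < P {ω | ∀ i, |ξ ω (φ i) - F n i| ≤ δ} := by
    by_contra hcon
    push Not at hcon
    have h0 : P (⋃ n, {ω | ∀ i, |ξ ω (φ i) - F n i| ≤ δ}) = 0 :=
      measure_iUnion_null fun n => le_antisymm (hcon n) (zero_le)
    have huniv : (⋃ n, {ω | ∀ i, |ξ ω (φ i) - F n i| ≤ δ}) = Set.univ :=
      Set.eq_univ_of_forall fun ω => Set.mem_iUnion.2 (hF ω)
    rw [huniv, measure_univ] at h0
    exact one_ne_zero h0
  set c := P {ω | ∀ i, |ξ ω (φ i) - F n i| ≤ δ} with hc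
  have hmeas : ∀ m : ℕ, NullMeasurableSet {ω | ∀ i < m, |ξ ω (φ i)| ≤ 2 * δ} P := fun m => by
    simp only [Set.ofPred_forall]
    exact NullMeasurableSet.iInter fun i => NullMeasurableSet.iInter fun _ =>
      nullMeasurableSet_le (hξ.aemeasurable (φ i)).abs aemeasurable_const
  -- Symmetrisation is applied to finitely many coordinates; the lower bound `c ^ 2` is independent
  -- of `m` and so survives the limit.
  have hfin : ∀ m : ℕ, c ^ 2 ≤ P {ω | ∀ i < m, |ξ ω (φ i)| ≤ 2 * δ} := by
    intro m
    classical
    set ψ : Fin m → 𝓢(Space d, ℝ) := fun i => φ i with hψ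
    have hae := hξ.aemeasurable_pi ψ
    have := hξ.isGaussian_map ψ
    have hcent : ∀ L : StrongDual ℝ (Fin m → ℝ),
        ∫ x, L x ∂(P.map fun ω i => ξ ω (ψ i)) = 0 := fun L => by
      have h1 := integral_map (μ := P.map fun ω i => ξ ω (ψ i))
        L.continuous.measurable.aemeasurable (f := fun t : ℝ => t)
        measurable_id.aestronglyMeasurable
      rw [← h1, hξ.map_strongDual, integral_id_gaussianReal]
    have hm : ∀ (g : Fin m → ℝ) (r : ℝ), MeasurableSet {x : Fin m → ℝ | ∀ i, |x i - g i| ≤ r} :=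
      fun g r => by
        simp only [Set.ofPred_forall]
        exact MeasurableSet.iInter fun i =>
          measurableSet_le (((measurable_pi_apply i).sub_const _).abs) measurable_const
    have hm0 : MeasurableSet {x : Fin m → ℝ | ∀ i, |x i| ≤ 2 * δ} := by
      simpa using hm 0 (2 * δ)
    have hcube := sq_measure_cube_le hcent (fun i => F n i) δ
    rw [Measure.map_apply_of_aemeasurable hae (hm _ _),
      Measure.map_apply_of_aemeasurable hae hm0] at hcube
    calc c ^ 2 ≤ _ := by
          rw [hc]
          gcongr
          exact fun ω hω i => hω i
      _ ≤ _ := hcube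
      _ ≤ _ := measure_mono fun ω hω i hi => hω ⟨i, hi⟩
  have hanti : Antitone fun m : ℕ => {ω | ∀ i < m, |ξ ω (φ i)| ≤ 2 * δ} :=
    fun m m' hmm ω hω i hi => hω i (hi.trans_le hmm)
  have hlim := tendsto_measure_iInter_atTop hmeas hanti ⟨0, measure_ne_top _ _⟩
  have hge := ge_of_tendsto hlim (Eventually.of_forall hfin)
  refine (ENNReal.pow_pos hn 2).trans_le (hge.trans (measure_mono fun ω hω i => ?_))
  exact Set.mem_iInter.1 hω (i + 1) i (Nat.lt_succ_self i)

end GaussianField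

/-! ### Existence of large nearly constant regions. -/

section FlatRegions

open Filter Topology

variable {d : ℕ} {Ω : Type*} [MeasurableSpace Ω] {P : Measure Ω} [IsProbabilityMeasure P]
  {ξ : Ω → (𝓢(Space d, ℝ) →L[ℝ] ℝ)}

theorem IsMollifier.integral_rescale {ϱ : Space d → ℝ} (hϱ : IsMollifier ϱ) {ε : ℝ}
    (hε : 0 < ε) : ∫ y, rescale ϱ ε y = 1 := by
  simp only [rescale]
  rw [integral_const_mul, Measure.integral_comp_inv_smul, hϱ.integral_eq_one,
    finrank_euclideanSpace_fin, abs_of_pos (by positivity), smul_eq_mul, mul_one,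
    inv_mul_cancel₀ (by positivity)]

/-- With positive probability, the regularised noise is close to `l` at a sequence of points of a
given ball. -/
theorem IsWhiteNoise.measure_near_const_pos (hξ : IsWhiteNoise P ξ) {ϱ : Space d → ℝ}
    (hϱ : IsMollifier ϱ) {ε : ℝ} (hε : 0 < ε) (hε1 : ε < 1) {R : ℝ} (hR : 0 < R)
    (x : ℕ → Space d) (hx : ∀ i, ‖x i‖ ≤ R) (l : ℝ) {δ : ℝ} (hδ : 0 < δ) :
    0 < P {ω | ∀ i, |smoothed hϱ hε (ξ ω) (x i) - l| ≤ 3 * δ} := by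
  obtain ⟨M, -, hcut⟩ := exists_cutoff d
  -- Since `ε < 1`, the cutoff is one on the support of every mollifier centred in the ball of
  -- radius `R`, so each pairs with `X` to give one.
  obtain ⟨χ, hχ, hχc, hχ0, hχ1, hχR, -⟩ := hcut (R + 1) (by positivity)
  set X : 𝓢(Space d, ℝ) := hχc.toSchwartzMap hχ with hX_def
  have hXa : ∀ y, X y = χ y := fun y => rfl
  set v := ∫ y, X y * X y with hv_def
  have hv : 0 < v := by
    have hcont : Continuous fun y => X y * X y := X.continuous.mul X.continuous
    refine hcont.integral_pos_of_hasCompactSupport_nonneg_nonzero ?_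
      (fun y => mul_self_nonneg _) (x := 0) ?_
    · exact HasCompactSupport.mul_left (f := fun y => X y) (f' := fun y => X y) hχc
    · simp [hXa, hχR 0 (by simp; positivity)]
  have hone : ∀ i, ∫ y, mollifierAt hϱ hε (x i) y * X y = 1 := fun i => by
    rw [← hϱ.integral_rescale hε, ← integral_sub_left_eq_self (rescale ϱ ε) volume (x i)]
    refine integral_congr_ae (Eventually.of_forall fun y => ?_)
    change rescale ϱ ε (x i - y) * χ y = rescale ϱ ε (x i - y)
    by_cases hy : ‖y‖ ≤ R + 1
    · rw [hχR y hy, mul_one]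
    · have h1 := norm_sub_norm_le y (x i)
      rw [norm_sub_rev] at h1
      rw [hϱ.rescale_eq_zero hε (by linarith [hx i]), zero_mul]
  -- The mollifiers with their `L²` projection onto `X` removed: the coefficient is `1 / ‖X‖² = v⁻¹`
  -- for every `i`. The removed part contributes the same random constant at all points.
  set η : ℕ → 𝓢(Space d, ℝ) := fun i => mollifierAt hϱ hε (x i) - v⁻¹ • X with hη_def
  have hηξ : ∀ ω i, ξ ω (η i) = smoothed hϱ hε (ξ ω) (x i) - v⁻¹ * ξ ω X := fun ω i => by
    simp [hη_def, smoothed]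
  have hcov : ∀ i, cov[fun ω => ξ ω (η i), fun ω => ξ ω X; P] = 0 := fun i => by
    rw [hξ.covariance_eq]
    have hpt : ∀ y, η i y * X y = mollifierAt hϱ hε (x i) y * X y - v⁻¹ * (X y * X y) := fun y => by
      simp only [hη_def, sub_apply, smul_apply, smul_eq_mul]
      ring
    simp_rw [hpt]
    rw [integral_sub (integrable_mul_schwartz _ _) ((integrable_mul_schwartz X X).const_mul _),
      hone, integral_const_mul, ← hv_def, inv_mul_cancel₀ hv.ne', sub_self]
  -- Jointly Gaussian families with zero cross-covariances are independent.
  have hind : IndepFun (fun ω i => ξ ω (η i)) (fun ω (_ : Unit) => ξ ω X) P := by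
    refine IsGaussianProcess.indepFun_of_covariance_eq_zero (X := fun i ω => ξ ω (η i))
      (Y := fun (_ : Unit) ω => ξ ω X) ?_ (fun i => hξ.aemeasurable _)
      (fun _ => hξ.aemeasurable _) (fun i _ => hcov i)
    have h := hξ.isGaussianProcess.comp_right (Sum.elim η fun _ : Unit => X)
    have heq : Sum.elim (fun i ω => ξ ω (η i)) (fun (_ : Unit) ω => ξ ω X) =
        (fun φ ω => ξ ω φ) ∘ Sum.elim η fun _ : Unit => X := by
      funext q
      rcases q with i | u <;> rfl
    rw [heq]
    exact h
  -- the oscillating part is small with positive probability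
  have hsmall : 0 < P {ω | ∀ i, |ξ ω (η i)| ≤ 2 * δ} := by
    have : Nonempty (Metric.closedBall (0 : Space d) R) := ⟨⟨0, by simp [hR.le]⟩⟩
    let K := Metric.closedBall (0 : Space d) R
    have : CompactSpace K := isCompact_iff_compactSpace.1 (isCompact_closedBall _ _)
    -- Separability of `C(K, ℝ)` supplies the countable cover by uniform balls required by
    -- `measure_small_pos`.
    let G : ℕ → C(K, ℝ) := TopologicalSpace.denseSeq C(K, ℝ)
    let p : ℕ → K := fun i => ⟨x i, mem_closedBall_zero_iff.2 (hx i)⟩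
    refine hξ.measure_small_pos η (fun n i => G n (p i)) fun ω => ?_
    let g : C(K, ℝ) := ⟨fun y => smoothed hϱ hε (ξ ω) y - v⁻¹ * ξ ω X,
      ((continuous_smoothed hϱ hε hε1 (ξ ω)).comp continuous_subtype_val).sub continuous_const⟩
    obtain ⟨n, hn⟩ := (TopologicalSpace.denseRange_denseSeq C(K, ℝ)).exists_dist_lt g hδ
    refine ⟨n, fun i => ?_⟩
    have h1 := (ContinuousMap.dist_apply_le_dist (f := g) (g := G n) (p i)).trans hn.le
    rw [Real.dist_eq] at h1
    rw [hηξ]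
    exact h1
  have hgauss : 0 < P {ω | |v⁻¹ * ξ ω X - l| ≤ δ} := by
    have hlaw := hξ X
    have hvv : (∫ y, X y ^ 2).toNNReal ≠ 0 := by
      have : ∫ y, X y ^ 2 = v := by simp only [hv_def, sq]
      rw [this]
      exact (Real.toNNReal_pos.2 hv).ne'
    have hmeas : MeasurableSet {t : ℝ | |v⁻¹ * t - l| ≤ δ} :=
      measurableSet_le (by fun_prop) measurable_const
    have hopen : IsOpen {t : ℝ | |v⁻¹ * t - l| < δ} := isOpen_lt (by fun_prop) continuous_const
    have hvol : volume {t : ℝ | |v⁻¹ * t - l| ≤ δ} ≠ 0 := by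
      refine ne_of_gt ((hopen.measure_pos volume ⟨v * l, ?_⟩).trans_le
        (measure_mono (Set.ofPred_subset_ofPred.2 fun t ht => ht.le)))
      change |v⁻¹ * (v * l) - l| < δ
      rw [inv_mul_cancel_left₀ hv.ne', sub_self, abs_zero]
      exact hδ
    have hne : gaussianReal 0 (∫ y, X y ^ 2).toNNReal {t : ℝ | |v⁻¹ * t - l| ≤ δ} ≠ 0 :=
      fun h0 => hvol (gaussianReal_absolutelyContinuous' 0 hvv h0)
    rw [← hlaw.map_eq, Measure.map_apply_of_aemeasurable hlaw.aemeasurable hmeas] at hne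
    exact pos_iff_ne_zero.2 hne
  have hms : MeasurableSet {f : ℕ → ℝ | ∀ i, |f i| ≤ 2 * δ} := by
    simp only [Set.ofPred_forall]
    exact MeasurableSet.iInter fun i => measurableSet_le (measurable_pi_apply i).abs
      measurable_const
  have hmt : MeasurableSet {f : Unit → ℝ | |v⁻¹ * f () - l| ≤ δ} :=
    measurableSet_le (by fun_prop) measurable_const
  have hprod := hind.measure_inter_preimage_eq_mul _ _ hms hmt
  have hpos : 0 < P ((fun ω i => ξ ω (η i)) ⁻¹' {f : ℕ → ℝ | ∀ i, |f i| ≤ 2 * δ} ∩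
      (fun ω (_ : Unit) => ξ ω X) ⁻¹' {f : Unit → ℝ | |v⁻¹ * f () - l| ≤ δ}) := by
    rw [hprod]
    exact ENNReal.mul_pos hsmall.ne' hgauss.ne'
  refine hpos.trans_le (measure_mono ?_)
  rintro ω ⟨h1, h2⟩ i
  have h1' : |ξ ω (η i)| ≤ 2 * δ := h1 i
  have h2' : |v⁻¹ * ξ ω X - l| ≤ δ := h2
  rw [hηξ] at h1'
  have := abs_add_le (smoothed hϱ hε (ξ ω) (x i) - v⁻¹ * ξ ω X) (v⁻¹ * ξ ω X - l)
  rw [sub_add_sub_cancel] at this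
  linarith

/-- The law of the regularised noise is invariant under translations. -/
theorem IsWhiteNoise.identDistrib_translate (hξ : IsWhiteNoise P ξ) {ϱ : Space d → ℝ}
    (hϱ : IsMollifier ϱ) {ε : ℝ} (hε : 0 < ε) (x : ℕ → Space d) (a : Space d) :
    IdentDistrib (fun ω i => smoothed hϱ hε (ξ ω) (a + x i))
      (fun ω i => smoothed hϱ hε (ξ ω) (x i)) P P := by
  refine (identDistrib_iff_forall_finset_identDistrib
    (X := fun i ω => smoothed hϱ hε (ξ ω) (a + x i))
    (Y := fun i ω => smoothed hϱ hε (ξ ω) (x i))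
    (hξ.aemeasurable_pi fun i => mollifierAt hϱ hε (a + x i))
    (hξ.aemeasurable_pi fun i => mollifierAt hϱ hε (x i))).2 fun I => ?_
  refine ⟨hξ.aemeasurable_pi fun i : I => mollifierAt hϱ hε (a + x i),
    hξ.aemeasurable_pi fun i : I => mollifierAt hϱ hε (x i), ?_⟩
  refine hξ.map_eq_map (φ := fun i : I => mollifierAt hϱ hε (a + x i))
    (φ' := fun i : I => mollifierAt hϱ hε (x i)) fun c => ?_
  -- Translation invariance of Lebesgue measure preserves the `L²` norms that determine the law.
  rw [← integral_add_left_eq_self _ a]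
  refine integral_congr_ae (Eventually.of_forall fun y => ?_)
  simp [mollifierAt_apply, add_sub_add_left_eq_sub]

/-- Almost surely, the regularised noise is close to `l` on some ball of radius `R`. -/
theorem IsWhiteNoise.ae_exists_flat (hd : 0 < d) (hξ : IsWhiteNoise P ξ) {ϱ : Space d → ℝ}
    (hϱ : IsMollifier ϱ) {ε : ℝ} (hε : 0 < ε) (hε1 : ε < 1) {R : ℝ} (hR : 0 < R) (l : ℝ) {δ : ℝ}
    (hδ : 0 < δ) :
    ∀ᵐ ω ∂P, ∃ a, ∀ y, ‖y - a‖ ≤ R → |smoothed hϱ hε (ξ ω) y - l| ≤ 3 * δ := by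
  have : Nonempty (Metric.closedBall (0 : Space d) R) := ⟨⟨0, by simp [hR.le]⟩⟩
  -- A dense sequence keeps the events countable, hence measurable; continuity recovers the whole
  -- ball at the end.
  let p : ℕ → Metric.closedBall (0 : Space d) R := TopologicalSpace.denseSeq _
  let x : ℕ → Space d := fun i => p i
  have hx : ∀ i, ‖x i‖ ≤ R := fun i => mem_closedBall_zero_iff.1 (p i).2
  have hq := hξ.measure_near_const_pos hϱ hε hε1 hR x hx l hδ
  set S : Set (ℕ → ℝ) := {f | ∀ i, |f i - l| ≤ 3 * δ} with hS_def
  have hS : MeasurableSet S := by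
    simp only [hS_def, Set.ofPred_forall]
    exact MeasurableSet.iInter fun i => measurableSet_le
      ((measurable_pi_apply i).sub_const _).abs measurable_const
  -- The spacing exceeds `2R + 2ε`, so mollifiers centred in different translated balls have
  -- disjoint supports and zero covariance.
  let a : ℕ → Space d := fun k => EuclideanSpace.single ⟨0, hd⟩ ((k : ℝ) * (2 * R + 3))
  have ha : ∀ k k', k ≠ k' → 2 * R + 3 ≤ ‖a k - a k'‖ := by
    intro k k' hkk
    have h1 : a k - a k' = EuclideanSpace.single ⟨0, hd⟩ (((k : ℝ) - k') * (2 * R + 3)) := by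
      ext i
      by_cases hi : i = ⟨0, hd⟩ <;> simp [a, hi, sub_mul]
    rw [h1, PiLp.norm_single, norm_mul, Real.norm_of_nonneg (by positivity : 0 ≤ 2 * R + 3)]
    have h2 : (1 : ℝ) ≤ ‖(k : ℝ) - k'‖ := by
      rw [Real.norm_eq_abs]
      have : (1 : ℤ) ≤ |(k : ℤ) - k'| := Int.one_le_abs (sub_ne_zero.2 (by exact_mod_cast hkk))
      exact_mod_cast this
    nlinarith
  let Z : ℕ → Ω → ℕ → ℝ := fun k ω i => smoothed hϱ hε (ξ ω) (a k + x i)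
  have hind : iIndepFun Z P := by
    refine IsGaussianProcess.iIndepFun_of_covariance_eq_zero (S := fun _ : ℕ => ℕ)
      (X := fun k i ω => smoothed hϱ hε (ξ ω) (a k + x i)) ?_ (fun k i => hξ.aemeasurable _)
      fun k k' hkk i j => ?_
    · exact hξ.isGaussianProcess.comp_right
        fun q : (_ : ℕ) × ℕ => mollifierAt hϱ hε (a q.1 + x q.2)
    · have hcov := hξ.covariance_eq (mollifierAt hϱ hε (a k + x i)) (mollifierAt hϱ hε (a k' + x j))
      refine hcov.trans ?_
      refine integral_eq_zero_of_ae (Eventually.of_forall fun y => ?_)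
      change rescale ϱ ε (a k + x i - y) * rescale ϱ ε (a k' + x j - y) = 0
      by_contra hne
      obtain ⟨hn1, hn2⟩ := mul_ne_zero_iff.1 hne
      have b1 : ‖a k + x i - y‖ ≤ ε := not_lt.1 fun h => hn1 (hϱ.rescale_eq_zero hε h)
      have b2 : ‖a k' + x j - y‖ ≤ ε := not_lt.1 fun h => hn2 (hϱ.rescale_eq_zero hε h)
      have b3 : a k - a k' = (a k + x i - y) - (a k' + x j - y) - x i + x j := by abel
      have b4 := ha k k' hkk
      rw [b3] at b4
      have b5 := norm_add_le ((a k + x i - y) - (a k' + x j - y) - x i) (x j)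
      have b6 := norm_sub_le ((a k + x i - y) - (a k' + x j - y)) (x i)
      have b7 := norm_sub_le (a k + x i - y) (a k' + x j - y)
      linarith [hx i, hx j]
  have hprob : ∀ k, P (Z k ⁻¹' Sᶜ) = P ({ω | ∀ i, |smoothed hϱ hε (ξ ω) (x i) - l| ≤ 3 * δ}ᶜ) :=
    fun k => (hξ.identDistrib_translate hϱ hε x (a k)).measure_mem_eq hS.compl
  set r := P ({ω | ∀ i, |smoothed hϱ hε (ξ ω) (x i) - l| ≤ 3 * δ}ᶜ) with hr
  have hr1 : r < 1 := by
    have hnull : NullMeasurableSet {ω | ∀ i, |smoothed hϱ hε (ξ ω) (x i) - l| ≤ 3 * δ} P :=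
      (hξ.aemeasurable_pi fun i => mollifierAt hϱ hε (x i)).nullMeasurable hS
    rw [hr, prob_compl_eq_one_sub₀ hnull]
    exact ENNReal.sub_lt_self ENNReal.one_ne_top one_ne_zero hq.ne'
  have hzero : P (⋂ k, Z k ⁻¹' Sᶜ) = 0 := by
    -- By independence and stationarity, failure in `n` translates has probability `r ^ n`, with `r
    -- < 1`.
    have hle : ∀ n : ℕ, P (⋂ k, Z k ⁻¹' Sᶜ) ≤ r ^ n := fun n => by
      calc P (⋂ k, Z k ⁻¹' Sᶜ) ≤ P (⋂ k ∈ Finset.range n, Z k ⁻¹' Sᶜ) :=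
            measure_mono fun ω hω => Set.mem_iInter₂.2 fun k _ => Set.mem_iInter.1 hω k
        _ = ∏ k ∈ Finset.range n, P (Z k ⁻¹' Sᶜ) :=
            hind.measure_inter_preimage_eq_mul _ fun _ _ => hS.compl
        _ = r ^ n := by rw [Finset.prod_congr rfl fun k _ => hprob k]; simp
    exact le_antisymm (ge_of_tendsto (ENNReal.tendsto_pow_atTop_nhds_zero_of_lt_one hr1)
      (Eventually.of_forall hle)) zero_le
  have hae : ∀ᵐ ω ∂P, ω ∉ ⋂ k, Z k ⁻¹' Sᶜ := measure_eq_zero_iff_ae_notMem.1 hzero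
  filter_upwards [hae] with ω hω
  simp only [Set.mem_iInter, not_forall] at hω
  obtain ⟨k, hk⟩ := hω
  have hk' : ∀ i, |smoothed hϱ hε (ξ ω) (a k + x i) - l| ≤ 3 * δ := by
    by_contra hcon
    exact hk hcon
  refine ⟨a k, fun y hy => ?_⟩
  have hcont := continuous_smoothed hϱ hε hε1 (ξ ω)
  have hclosed : IsClosed {q : Metric.closedBall (0 : Space d) R |
      |smoothed hϱ hε (ξ ω) (a k + q) - l| ≤ 3 * δ} :=
    isClosed_le (by fun_prop) continuous_const
  have := (TopologicalSpace.denseRange_denseSeq (Metric.closedBall (0 : Space d) R)).induction_on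
    (p := fun q => |smoothed hϱ hε (ξ ω) (a k + q) - l| ≤ 3 * δ)
    ⟨y - a k, mem_closedBall_zero_iff.2 hy⟩ hclosed hk'
  simpa using this

/-- Almost surely, the regularised noise is nearly equal to any given constant on arbitrarily large
balls. -/
theorem IsWhiteNoise.ae_forall_exists_flat (hd : 0 < d) (hξ : IsWhiteNoise P ξ) {ϱ : Space d → ℝ}
    (hϱ : IsMollifier ϱ) {ε : ℝ} (hε : 0 < ε) (hε1 : ε < 1) :
    ∀ᵐ ω ∂P, ∀ l : ℝ, ∀ δ > 0, ∀ R > 0, ∃ a, ∀ y, ‖y - a‖ ≤ R →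
      |smoothed hϱ hε (ξ ω) y - l| ≤ δ := by
  -- Rational levels, tolerances `3 / (n + 1)` and radii `m + 1` reduce the claim to countably many
  -- null sets. In the approximation, three quarters of `δ` go to the tolerance and one quarter to
  -- the level.
  have h : ∀ (q : ℚ) (n m : ℕ), ∀ᵐ ω ∂P, ∃ a, ∀ y, ‖y - a‖ ≤ (m + 1 : ℝ) →
      |smoothed hϱ hε (ξ ω) y - q| ≤ 3 * (1 / (n + 1 : ℝ)) := fun q n m =>
    hξ.ae_exists_flat hd hϱ hε hε1 (by positivity) q (by positivity)
  simp only [← ae_all_iff] at h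
  filter_upwards [h] with ω hω l δ hδ R _
  obtain ⟨q, hq1, hq2⟩ := exists_rat_btwn (show l - δ / 4 < l + δ / 4 by linarith)
  obtain ⟨n, hn⟩ := exists_nat_one_div_lt (show 0 < δ / 4 by positivity)
  obtain ⟨m, hm⟩ := exists_nat_ge R
  obtain ⟨a, ha⟩ := hω q n m
  refine ⟨a, fun y hy => ?_⟩
  have h1 := ha y (by linarith)
  have h2 : |(q : ℝ) - l| ≤ δ / 4 := abs_le.2 ⟨by linarith, by linarith⟩
  have h3 := abs_add_le (smoothed hϱ hε (ξ ω) y - q) (q - l)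
  rw [sub_add_sub_cancel] at h3
  linarith

end FlatRegions

end AndersonHamiltonian
end

theorem proposition5p2 {d : ℕ} (hd : d = 2 ∨ d = 3)
    {Ω : Type*} [MeasurableSpace Ω] (P : Measure Ω) [IsProbabilityMeasure P]
    (ξ : Ω → (𝓢(AndersonHamiltonian.Space d, ℝ) →L[ℝ] ℝ))
    (hξ : AndersonHamiltonian.IsWhiteNoise P ξ)
    (ϱ : AndersonHamiltonian.Space d → ℝ) (hϱ : AndersonHamiltonian.IsMollifier ϱ)
    (ε : ℝ) (hε : 0 < ε) (hε1 : ε < 1) (C : ℝ) :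
    ∀ᵐ ω ∂P,
      IsSelfAdjoint (AndersonHamiltonian.smoothedHamiltonian hϱ hε C (ξ ω)) ∧
      AndersonHamiltonian.spectrum (AndersonHamiltonian.smoothedHamiltonian hϱ hε C (ξ ω)) =
        Set.range ((↑) : ℝ → ℂ) := by
  filter_upwards [hξ.ae_linear_growth hϱ hε hε1,
    hξ.ae_forall_exists_flat (by omega) hϱ hε hε1] with ω hgrowth hflat
  obtain ⟨c, hc⟩ := hgrowth
  have hV : Continuous fun x => AndersonHamiltonian.smoothed hϱ hε (ξ ω) x + C :=
    (AndersonHamiltonian.continuous_smoothed hϱ hε hε1 (ξ ω)).add continuous_const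
  have hgr : ∀ x, |AndersonHamiltonian.smoothed hϱ hε (ξ ω) x + C| ≤ (c + |C|) * (1 + ‖x‖) := by
    intro x
    have h1 := abs_add_le (AndersonHamiltonian.smoothed hϱ hε (ξ ω) x) C
    nlinarith [hc x, abs_nonneg C, norm_nonneg x, mul_nonneg (abs_nonneg C) (norm_nonneg x)]
  refine ⟨AndersonHamiltonian.isSelfAdjoint_schrodinger hV hgr,
    AndersonHamiltonian.spectrum_schrodinger hV hgr fun l δ hδ R hR => ?_⟩
  -- The constant only shifts the level that the noise must approach.
  obtain ⟨a, ha⟩ := hflat (l - C) δ hδ R hR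
  refine ⟨a, fun y hy => ?_⟩
  have := ha y hy
  rwa [sub_sub_eq_add_sub] at this
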